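/- Let $(\mathbb X,\mathcal X)$ be a measurable space with a $\sigma$-finite measure $\mu$, and let $\mathbf N$ be the set of $\sigma$-finite measures on $\mathbb X$ with values in $\{0,1,2,\dots\}\cup\{\infty\}$, equipped with the $\sigma$-field generated by the maps $\nu\mapsto\nu(B)$, $B\in\mathcal X$. Let $\xi$ be a Poisson process on $\mathbb X$ with intensity measure $\mu$, i.e. a random element of $\mathbf N$ such that $\xi(B)$ is Poisson distributed with parameter $\mu(B)$ for every $B\in\mathcal X$ (with $\xi(B)=\infty$ almost surely if $\mu(B)=\infty$) and $\xi(B_1),\dots,\xi(B_n)$ are independent for pairwise disjoint $B_1,\dots,B_n\in\mathcal X$, $n\ge 1$. For a measurable $f:\mathbf N\to\mathbb R$ and $F=f(\xi)$ put $D_xF=f(\xi+\delta_x)-f(\xi)$ for $x\in\mathbb X$, and iteratively $D^1_xF=D_xF$ and $D^n_{x_1,\dots,x_n}F=D_{x_1}\bigl(D^{n-1}_{x_2,\dots,x_n}F\bigr)$ for $n\ge2$. For every real $\alpha\ge 0$ and every integer $k\ge 1$ there is a constant $c(\alpha,k)>0$, depending only on $\alpha$ and $k$, such that the following holds for all $(\mathbb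 X,\mathcal X)$, $\mu$, $\xi$ and $F=f(\xi)$ as above with $\mathbb E[F^2]<\infty$. If $$\mathbb E\int (D^{k+1}_{x_1,\dots,x_{k+1}}F)^2\,\mu^{k+1}(\mathrm d(x_1,\dots,x_{k+1}))\le \alpha\,\mathbb E\int (D^{k}_{x_1,\dots,x_{k}}F)^2\,\mu^{k}(\mathrm d(x_1,\dots,x_{k}))<\infty$$ (with the convention $0\cdot\infty=0$), then $$\operatorname{Var}[F]\ge\frac1{c(\alpha,k)}\,\mathbb E\int (D^{k}_{x_1,\dots,x_{k}}F)^2\,\mu^{k}(\mathrm d(x_1,\dots,x_{k})).$$ -/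

import Mathlib

open MeasureTheory ProbabilityTheory
open scoped ENNReal

noncomputable section

/-- The set `N` of σ-finite counting measures on `X`: σ-finite measures with values in `ℕ ∪ {∞}`.
As a subtype of `Measure X` it carries the σ-field generated by the maps `ν ↦ ν B` for
measurable `B`. -/
abbrev CountingMeasures (X : Type*) [MeasurableSpace X] : Type _ :=
  {ν : Measure X // SigmaFinite ν ∧ ∀ B : Set X, MeasurableSet B → ∃ n : ℕ∞, ν B = (n : ℝ≥0∞)}

/-- The measure `ν + δ_x`. -/
def addPoint {X : Type*} [MeasurableSpace X] (x : X) (ν : CountingMeasures X) :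
    CountingMeasures X :=
  ⟨ν.1 + Measure.dirac x, by
    obtain ⟨ν, h₁, h₂⟩ := ν
    refine ⟨inferInstance, fun B hB => ?_⟩
    obtain ⟨n, hn⟩ := h₂ B hB
    by_cases hx : x ∈ B
    · exact ⟨n + 1, by simp [Measure.dirac_apply' x hB, hx, hn]⟩
    · exact ⟨n, by simp [Measure.dirac_apply' x hB, hx, hn]⟩⟩

/-- The Poisson distribution with parameter `r ∈ [0, ∞]`, as a law on `[0, ∞]`; for `r = ∞` it is
the point mass at `∞`. -/
def poissonLaw (r : ℝ≥0∞) : Measure ℝ≥0∞ :=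
  if r = ∞ then Measure.dirac ∞
  else (poissonMeasure r.toNNReal).map (fun n : ℕ => (n : ℝ≥0∞))

/-- `ξ` is a Poisson process on `X` with intensity measure `μ`, defined on the probability space
`(Ω, P)`. -/
structure IsPoissonProcess {X Ω : Type*} [MeasurableSpace X] [MeasurableSpace Ω]
    (ξ : Ω → CountingMeasures X) (μ : Measure X) (P : Measure Ω) : Prop where
  measurable : Measurable ξ
  map_eq : ∀ B : Set X, MeasurableSet B → P.map (fun ω => (ξ ω).1 B) = poissonLaw (μ B)
  indep : ∀ (n : ℕ) (B : Fin n → Set X), (∀ i, MeasurableSet (B i)) →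
    Pairwise (fun i j => Disjoint (B i) (B j)) →
    iIndepFun (fun (i : Fin n) (ω : Ω) => (ξ ω).1 (B i)) P

/-- The difference operator `D_x f (ν) = f (ν + δ_x) - f (ν)`. -/
def diffOp {X : Type*} [MeasurableSpace X] (x : X) (f : CountingMeasures X → ℝ) :
    CountingMeasures X → ℝ :=
  fun ν => f (addPoint x ν) - f ν

/-- The iterated difference operator
`D^n_{x_1, …, x_n} f = D_{x_1} (D^{n-1}_{x_2, …, x_n} f)`, with `D^0 f = f`. -/
def iterDiffOp {X : Type*} [MeasurableSpace X] :
    (n : ℕ) → (Fin n → X) → (CountingMeasures X → ℝ) → CountingMeasures X → ℝ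
  | 0, _, f => f
  | n + 1, x, f => diffOp (x 0) (iterDiffOp n (Fin.tail x) f)

/-- The quantity `E ∫ (D^n_{x_1, …, x_n} F)² μ^n(d(x_1, …, x_n)) ∈ [0, ∞]` for `F = f(ξ)`. -/
def diffEnergy {X Ω : Type*} [MeasurableSpace X] [MeasurableSpace Ω]
    (μ : Measure X) (P : Measure Ω) (ξ : Ω → CountingMeasures X)
    (f : CountingMeasures X → ℝ) (n : ℕ) : ℝ≥0∞ :=
  ∫⁻ ω, ∫⁻ x : Fin n → X, ENNReal.ofReal ((iterDiffOp n x f (ξ ω)) ^ 2)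
    ∂(Measure.pi fun _ : Fin n => μ) ∂P

end

/-! Let a_n be the energy of order n of the centred functional, so that a_0 = Var F. The core is the
interpolation inequality a_{n+1} ≤ t a_n + t⁻¹ a_{n+2} for all t ≥ 1. For n = 0, put v_x = D_x f and
let Z be the compensated sum of v. Formally, duality gives a_1 = E[f Z] and the isometry gives E[Z²]
= a_1 + a_2. From 2 f Z ≤ t f² + t⁻¹ Z² it follows that 2 a_1 ≤ t a_0 + t⁻¹ (a_1 + a_2), and t⁻¹ a_1
≤ a_1 is absorbed. Duality and isometry (`IsMeckeTriple.integral_mul_compensatedSum`,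
`IsMeckeTriple.integral_compensatedSum_sq`) both come from Mecke's equation; v is truncated to make
them legitimate. Applying the case n = 0 to iterated differences gives every n.

Chaining these inequalities (`exists_interpolation_const`) yields a_k ≤ C a_0 + ε a_{k+1} with ε
arbitrary. Under a_{k+1} ≤ α a_k and εα ≤ 1/2 the last term is absorbed.

Absorption needs finite intermediate energies, which are not assumed. Hence added points are
confined to a set B of finite intensity, while f still sees the whole process. Splitting according
to the number of points in B then shows that a_0 and a_{n+1} finite force a_n finite
(`IsMeckeTriple.energyOn_ne_top_of_succ`). Since C does not depend on B, monotone convergence along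
an exhaustion by such sets concludes. -/

/-! ### Mecke's equation for independent Poisson variables -/

/-- The weights satisfy (n + 1) p(n + 1) = r p(n), and the term n = 0 vanishes. -/
theorem lintegral_poissonLaw_mul {r : ℝ≥0∞} (hr : r ≠ ∞) {ψ : ℝ≥0∞ → ℝ≥0∞} (hψ : Measurable ψ) :
    ∫⁻ t, t * ψ t ∂poissonLaw r = r * ∫⁻ t, ψ (t + 1) ∂poissonLaw r := by
  lift r to NNReal using hr
  have hm : Measurable (fun n : ℕ => (n : ℝ≥0∞)) := measurable_of_countable _
  have key : ∀ n : ℕ, poissonMeasure r {n + 1} * ((n + 1 : ℕ) : ℝ≥0∞)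
      = r * poissonMeasure r {n} := by
    intro n
    rw [poissonMeasure_singleton, poissonMeasure_singleton, ← ENNReal.ofReal_natCast,
      ← ENNReal.ofReal_mul (by positivity), ← ENNReal.ofReal_coe_nnreal,
      ← ENNReal.ofReal_mul (by positivity)]
    congr 1
    rw [Nat.factorial_succ]
    push_cast
    have : (n.factorial : ℝ) ≠ 0 := by positivity
    have : (n : ℝ) + 1 ≠ 0 := by positivity
    field_simp
    ring
  rw [poissonLaw, if_neg ENNReal.coe_ne_top, ENNReal.toNNReal_coe,
    lintegral_map (by fun_prop) hm, lintegral_map (by fun_prop) hm,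
    lintegral_countable', lintegral_countable', tsum_eq_zero_add' ENNReal.summable,
    ← ENNReal.tsum_mul_left]
  simp only [Nat.cast_zero, zero_mul, zero_add]
  refine tsum_congr fun n => ?_
  rw [mul_right_comm, mul_comm _ (poissonMeasure r _), key]
  push_cast
  ring

instance isProbabilityMeasure_poissonLaw (r : ℝ≥0∞) : IsProbabilityMeasure (poissonLaw r) := by
  unfold poissonLaw
  split_ifs
  · infer_instance
  · exact Measure.isProbabilityMeasure_map (measurable_of_countable _).aemeasurable

theorem lintegral_pi_poissonLaw_mul {ι : Type*} [Fintype ι] [DecidableEq ι] (r : ι → ℝ≥0∞) {i : ι}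
    (hi : r i ≠ ∞) {φ : (ι → ℝ≥0∞) → ℝ≥0∞} (hφ : Measurable φ) :
    ∫⁻ t, t i * φ t ∂Measure.pi (fun j => poissonLaw (r j))
      = r i * ∫⁻ t, φ (t + Pi.single i 1) ∂Measure.pi (fun j => poissonLaw (r j)) := by
  have hs : Measurable fun t : ι → ℝ≥0∞ => φ (t + Pi.single i 1) := by fun_prop
  rw [← lintegral_const_mul _ hs]
  refine lintegral_eq_of_lmarginal_eq {i} (by fun_prop) (by fun_prop) ?_
  funext x
  rw [lmarginal_singleton, lmarginal_singleton]
  simp only [Function.update_self]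
  have hu : Measurable fun s => φ (Function.update x i s) := hφ.comp (measurable_update x)
  rw [lintegral_poissonLaw_mul hi hu,
    lintegral_const_mul (r i) (f := fun s => φ (Function.update x i s + Pi.single i 1))
      (hs.comp (measurable_update x))]
  congr 1
  refine lintegral_congr fun s => congrArg φ ?_
  funext j
  by_cases hj : j = i
  · subst hj; simp
  · simp [hj]

/-! ### Mecke's equation for finitely many counts of the process -/

section

variable {X : Type*} [MeasurableSpace X]

theorem CountingMeasures.measurable_coe {B : Set X} (hB : MeasurableSet B) :
    Measurable fun ν : CountingMeasures X => ν.1 B :=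
  (Measure.measurable_coe hB).comp measurable_subtype_coe

theorem CountingMeasures.measurable_of_coe {Y : Type*} [MeasurableSpace Y]
    {g : Y → CountingMeasures X}
    (hg : ∀ B : Set X, MeasurableSet B → Measurable fun y => (g y).1 B) : Measurable g :=
  Measurable.subtype_mk (Measure.measurable_of_measurable_coe _ hg)

theorem addPoint_apply (x : X) (ν : CountingMeasures X) {B : Set X} (hB : MeasurableSet B) :
    (addPoint x ν).1 B = ν.1 B + B.indicator 1 x := by
  simp [addPoint, Measure.dirac_apply' x hB]

theorem addPoint_comm (x y : X) (ν : CountingMeasures X) :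
    addPoint x (addPoint y ν) = addPoint y (addPoint x ν) := by
  apply Subtype.ext
  simp only [addPoint]
  abel

@[fun_prop]
theorem measurable_addPoint : Measurable fun p : CountingMeasures X × X => addPoint p.2 p.1 := by
  refine CountingMeasures.measurable_of_coe fun B hB => ?_
  simp only [addPoint_apply _ _ hB]
  exact ((CountingMeasures.measurable_coe hB).comp measurable_fst).add
    ((measurable_one.indicator hB).comp measurable_snd)

theorem Measurable.addPoint {Y : Type*} [MeasurableSpace Y] {g : Y → CountingMeasures X} {h : Y → X}
    (hg : Measurable g) (hh : Measurable h) : Measurable fun y => addPoint (h y) (g y) :=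
  measurable_addPoint.comp (hg.prodMk hh)

variable {Ω : Type*} [MeasurableSpace Ω] {ξ : Ω → CountingMeasures X} {μ : Measure X}
  {P : Measure Ω}

theorem IsPoissonProcess.map_cells (h : IsPoissonProcess ξ μ P) [IsProbabilityMeasure P]
    {ι : Type*} [Fintype ι] {A : ι → Set X} (hA : ∀ i, MeasurableSet (A i))
    (hd : Pairwise fun i j => Disjoint (A i) (A j)) :
    P.map (fun ω i => (ξ ω).1 (A i)) = Measure.pi fun i => poissonLaw (μ (A i)) := by
  let e := Fintype.equivFin ι
  have hind := h.indep (Fintype.card ι) (fun j => A (e.symm j)) (fun _ => hA _)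
    (fun i j hij => hd (e.symm.injective.ne hij))
  have hind' := hind.precomp e.injective
  have hm : ∀ i, Measurable fun ω => (ξ ω).1 (A i) :=
    fun i => (CountingMeasures.measurable_coe (hA i)).comp h.measurable
  simp only [Equiv.symm_apply_apply] at hind'
  rw [(iIndepFun_iff_map_fun_eq_pi_map (fun i => (hm i).aemeasurable)).1 hind']
  simp only [h.map_eq _ (hA _)]

/-- Mecke's equation for functionals of finitely many counts. -/
theorem IsPoissonProcess.lintegral_cells (h : IsPoissonProcess ξ μ P) [IsProbabilityMeasure P]
    {ι : Type*} [Fintype ι] [DecidableEq ι] {A : ι → Set X} (hA : ∀ i, MeasurableSet (A i))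
    (hd : Pairwise fun i j => Disjoint (A i) (A j)) {i : ι} (hi : μ (A i) ≠ ∞)
    {φ : (ι → ℝ≥0∞) → ℝ≥0∞} (hφ : Measurable φ) :
    ∫⁻ ω, (ξ ω).1 (A i) * φ (fun j => (ξ ω).1 (A j)) ∂P
      = ∫⁻ x in A i, ∫⁻ ω, φ (fun j => (addPoint x (ξ ω)).1 (A j)) ∂P ∂μ := by
  have hm : Measurable fun ω i => (ξ ω).1 (A i) :=
    measurable_pi_lambda _ fun i => (CountingMeasures.measurable_coe (hA i)).comp h.measurable
  have h1 := lintegral_pi_poissonLaw_mul (fun j => μ (A j)) hi hφ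
  rw [← h.map_cells hA hd, lintegral_map (by fun_prop) hm, lintegral_map (by fun_prop) hm] at h1
  rw [h1, mul_comm, ← setLIntegral_const]
  refine setLIntegral_congr_fun (hA i) fun x hx => lintegral_congr fun ω => congrArg φ ?_
  funext j
  rw [addPoint_apply _ _ (hA j)]
  by_cases hj : j = i
  · subst hj; simp [hx]
  · have : x ∉ A j := fun hxj => Set.disjoint_left.1 (hd hj) hxj hx
    simp [hj, this]

theorem measure_eq_sum_cells {ι : Type*} [Fintype ι] (c : X → ι)
    (hc : ∀ b, MeasurableSet (c ⁻¹' {b})) (p : ι → Prop) [DecidablePred p] (ν : Measure X) :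
    ν {x | p (c x)} = ∑ b with p b, ν (c ⁻¹' {b}) := by
  rw [← measure_biUnion_finset (fun a _ b _ hab => by
    rw [Function.onFun, Set.disjoint_left]
    rintro x rfl h2
    exact hab h2) (fun b _ => hc b)]
  congr 1
  ext x
  simp

/-- Independence is only available for disjoint sets, so the possibly overlapping `C j` and `D` are
cut into the atoms of the finite algebra they generate; the disjoint case is summed over the atoms
inside `D`. -/
theorem IsPoissonProcess.lintegral_coe_mul (h : IsPoissonProcess ξ μ P) [IsProbabilityMeasure P]
    {ι : Type*} [Finite ι] {C : ι → Set X} (hC : ∀ i, MeasurableSet (C i))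
    {D : Set X} (hD : MeasurableSet D) (hfin : μ D ≠ ∞)
    {φ : (ι → ℝ≥0∞) → ℝ≥0∞} (hφ : Measurable φ) :
    ∫⁻ ω, (ξ ω).1 D * φ (fun j => (ξ ω).1 (C j)) ∂P
      = ∫⁻ x in D, ∫⁻ ω, φ (fun j => (addPoint x (ξ ω)).1 (C j)) ∂P ∂μ := by
  classical
  have := Fintype.ofFinite ι
  let C' : Option ι → Set X := fun o => o.elim D C
  have hC' : ∀ o, MeasurableSet (C' o) := by
    rintro (_ | i)
    exacts [hD, hC i]
  let c : X → Option ι → Bool := fun x o => decide (x ∈ C' o)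
  have hc : ∀ b, MeasurableSet (c ⁻¹' {b}) := by
    intro b
    have : c ⁻¹' {b} = ⋂ o, {x | decide (x ∈ C' o) = b o} := by
      ext x; simp [c, funext_iff]
    rw [this]
    refine MeasurableSet.iInter fun o => ?_
    cases hb : b o
    · simp only [decide_eq_false_iff_not]
      exact (hC' o).compl
    · simp only [decide_eq_true_eq]
      exact hC' o
  have hd : Pairwise fun a b => Disjoint (c ⁻¹' {a}) (c ⁻¹' {b}) := by
    intro a b hab
    rw [Set.disjoint_left]
    rintro x rfl h2
    exact hab h2
  have hsum : ∀ (ν : Measure X) (o : Option ι),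
      ν (C' o) = ∑ b : Option ι → Bool with b o = true, ν (c ⁻¹' {b}) := by
    intro ν o
    rw [← measure_eq_sum_cells c hc (fun b => b o = true)]
    simp [c]
  let φ' : ((Option ι → Bool) → ℝ≥0∞) → ℝ≥0∞ :=
    fun t => φ fun j => ∑ b : Option ι → Bool with b (some j) = true, t b
  have hφ' : Measurable φ' := by
    refine hφ.comp (measurable_pi_lambda _ fun j => ?_)
    fun_prop
  have hφφ' : ∀ ν : Measure X, φ (fun j => ν (C j)) = φ' fun b => ν (c ⁻¹' {b}) := by
    intro ν
    simp only [φ', ← hsum]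
    rfl
  -- Only atoms inside `D` carry the weight, so only these need finite intensity; the `C j` may have
  -- infinite intensity.
  have hcells : ∀ b : Option ι → Bool, b none = true → μ (c ⁻¹' {b}) ≠ ∞ := by
    intro b hb
    refine measure_ne_top_of_subset (fun x hx => ?_) hfin
    have : c x none = true := by rw [show c x = b from hx, hb]
    simpa [c] using! this
  have hDU : D =
      ⋃ b ∈ Finset.univ.filter (fun b : Option ι → Bool => b none = true), c ⁻¹' {b} := by
    ext x
    simp only [Finset.mem_filter_univ, Set.mem_iUnion, Set.mem_preimage, Set.mem_singleton_iff,
      exists_prop, exists_eq_right']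
    exact decide_eq_true_iff.symm
  have hmξ : ∀ b, Measurable fun ω => (ξ ω).1 (c ⁻¹' {b}) :=
    fun b => (CountingMeasures.measurable_coe (hc b)).comp h.measurable
  simp only [hφφ']
  have hsumD : ∀ ω, (ξ ω).1 D
      = ∑ b : Option ι → Bool with b none = true, (ξ ω).1 (c ⁻¹' {b}) := fun ω => hsum _ none
  conv_rhs => rw [hDU]
  rw [lintegral_biUnion_finset (fun a _ b _ hab => hd hab) (fun b _ => hc b)]
  simp only [hsumD, Finset.sum_mul]
  have hmφ : Measurable fun ω => φ' fun b => (ξ ω).1 (c ⁻¹' {b}) :=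
    hφ'.comp (measurable_pi_lambda _ hmξ)
  rw [lintegral_finsetSum _ fun b _ => by fun_prop]
  refine Finset.sum_congr rfl fun b hb => ?_
  exact h.lintegral_cells hc hd (hcells b (by simpa using hb)) hφ'

/-! ### Mecke's equation for the law of the process -/

/-- Finite intersections of sets `{ν | ν C ∈ E}`. -/
def countCylinders (X : Type*) [MeasurableSpace X] : Set (Set (CountingMeasures X)) :=
  piiUnionInter (fun C : Set X => {s | MeasurableSet[(inferInstance : MeasurableSpace ℝ≥0∞).comap
    fun ν : CountingMeasures X => ν.1 C] s}) {C | MeasurableSet C}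

theorem isPiSystem_countCylinders : IsPiSystem (countCylinders X) :=
  isPiSystem_piiUnionInter _
    (fun _ => @MeasurableSpace.isPiSystem_measurableSet _ (MeasurableSpace.comap _ _)) _

theorem generateFrom_countCylinders :
    (inferInstance : MeasurableSpace (CountingMeasures X))
      = MeasurableSpace.generateFrom (countCylinders X) := by
  rw [countCylinders, generateFrom_piiUnionInter_measurableSet (fun C : Set X =>
    (inferInstance : MeasurableSpace ℝ≥0∞).comap fun ν : CountingMeasures X => ν.1 C)]
  apply le_antisymm
  · refine fun s hs => @CountingMeasures.measurable_of_coe X _ _ (_) id (fun B hB => ?_) s hs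
    refine Measurable.of_comap_le ?_
    exact le_iSup₂ (f := fun (C : Set X) (_ : C ∈ {C | MeasurableSet C}) =>
      (inferInstance : MeasurableSpace ℝ≥0∞).comap fun ν : CountingMeasures X => ν.1 C) B hB
  · exact iSup₂_le fun C hC => (CountingMeasures.measurable_coe hC).comap_le

/-- The restriction to `B` of the counting measures with exactly `n` points in `B`. -/
noncomputable def restrictKernelOfCount {B : Set X} (hB : MeasurableSet B) (n : ℕ) :
    Kernel (CountingMeasures X) X where
  toFun ν := open Classical in if ν.1 B = n then ν.1.restrict B else 0
  measurable' := by
    classical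
    exact Measurable.ite (CountingMeasures.measurable_coe hB (measurableSet_singleton _))
      (Measure.measurable_of_measurable_coe _ fun s hs => by
        simp only [Measure.restrict_apply hs]
        exact CountingMeasures.measurable_coe (hs.inter hB)) measurable_const

instance {B : Set X} (hB : MeasurableSet B) (n : ℕ) :
    IsFiniteKernel (restrictKernelOfCount hB n) := by
  refine ⟨⟨n, ENNReal.natCast_lt_top n, fun ν => ?_⟩⟩
  classical
  change (if ν.1 B = n then ν.1.restrict B else 0) Set.univ ≤ n
  split_ifs with h
  · simp [h]
  · simp

/-- The kernel mapping a counting measure to its restriction to `B` if that is finite, and to `0`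
otherwise. -/
noncomputable def restrictKernel {B : Set X} (hB : MeasurableSet B) :
    Kernel (CountingMeasures X) X :=
  Kernel.sum (restrictKernelOfCount hB)

instance {B : Set X} (hB : MeasurableSet B) : IsSFiniteKernel (restrictKernel hB) := by
  unfold restrictKernel
  infer_instance

theorem CountingMeasures.exists_nat_of_ne_top (ν : CountingMeasures X) {B : Set X}
    (hB : MeasurableSet B) (h : ν.1 B ≠ ∞) : ∃ n : ℕ, ν.1 B = n := by
  obtain ⟨n, hn⟩ := ν.2.2 B hB
  induction n using ENat.recTopCoe with
  | top => exact absurd hn (by simpa using h)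
  | coe n => exact ⟨n, by simpa using hn⟩

theorem restrictKernel_apply {B : Set X} (hB : MeasurableSet B) {ν : CountingMeasures X}
    (h : ν.1 B ≠ ∞) : restrictKernel hB ν = ν.1.restrict B := by
  classical
  obtain ⟨n, hn⟩ := ν.exists_nat_of_ne_top hB h
  ext s hs
  rw [restrictKernel, Kernel.sum_apply' _ _ hs, tsum_eq_single n]
  · change (if ν.1 B = n then ν.1.restrict B else 0) s = _
    rw [if_pos hn]
  · intro m hm
    change (if ν.1 B = m then ν.1.restrict B else 0) s = _
    rw [if_neg (by rw [hn]; exact_mod_cast hm.symm)]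
    simp

/-- A law `Q` of counting measures, a measure `ρ` and a kernel `κ` selecting part of the points of
a counting measure that satisfy Mecke's equation
`E ∫ g(ξ, x) κ(ξ, dx) = E ∫ g(ξ + δ_x, x) ρ(dx)`. -/
structure IsMeckeTriple (Q : Measure (CountingMeasures X)) (ρ : Measure X)
    (κ : Kernel (CountingMeasures X) X) : Prop where
  compProd_eq : Q ⊗ₘ κ = (Q.prod ρ).map fun p => (addPoint p.2 p.1, p.2)
  ae_addPoint : ∀ᵐ ν ∂Q, ∀ᵐ x ∂ρ, κ (addPoint x ν) = κ ν + Measure.dirac x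
  ae_nat : ∀ᵐ ν ∂Q, ∃ n : ℕ, κ ν Set.univ = n

theorem IsPoissonProcess.lintegral_coe (h : IsPoissonProcess ξ μ P) [IsProbabilityMeasure P]
    {D : Set X} (hD : MeasurableSet D) (hfin : μ D ≠ ∞) :
    ∫⁻ ν, ν.1 D ∂P.map ξ = μ D := by
  have := h.lintegral_coe_mul (ι := Empty) (C := fun _ => ∅) (fun _ => .empty) hD hfin
    (φ := fun _ => 1) measurable_const
  rw [lintegral_map (CountingMeasures.measurable_coe hD) h.measurable]
  simpa using this

/-- Mecke's equation, for a fixed set of finite intensity. -/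
theorem IsPoissonProcess.withDensity_eq (h : IsPoissonProcess ξ μ P) [IsProbabilityMeasure P]
    [SigmaFinite μ] {D : Set X} (hD : MeasurableSet D) (hfin : μ D ≠ ∞) :
    (P.map ξ).withDensity (fun ν => ν.1 D)
      = ((P.map ξ).prod (μ.restrict D)).map fun p => addPoint p.2 p.1 := by
  have hP : IsProbabilityMeasure (P.map ξ) :=
    Measure.isProbabilityMeasure_map h.measurable.aemeasurable
  have huniv : (P.map ξ).withDensity (fun ν => ν.1 D) Set.univ = μ D := by
    rw [withDensity_apply _ .univ, setLIntegral_univ, h.lintegral_coe hD hfin]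
  have : IsFiniteMeasure ((P.map ξ).withDensity (fun ν => ν.1 D)) :=
    ⟨by rw [huniv]; exact hfin.lt_top⟩
  -- Both measures have total mass `μ D`, so agreement on the π-system of cylinders suffices; a
  -- cylinder is the event that finitely many counts lie in a product set.
  refine ext_of_generate_finite _ generateFrom_countCylinders isPiSystem_countCylinders ?_ ?_
  · rintro A hA'
    have hA : MeasurableSet A :=
      generateFrom_countCylinders.ge _ (MeasurableSpace.measurableSet_generateFrom hA')
    obtain ⟨S, hS, g, hg, rfl⟩ := hA'
    have hg' : ∀ C : S, ∃ E : Set ℝ≥0∞, MeasurableSet E ∧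
        (fun ν : CountingMeasures X => ν.1 C.1) ⁻¹' E = g C.1 := fun C => hg C.1 C.2
    choose E hE hEg using hg'
    let T : Set (S → ℝ≥0∞) := Set.univ.pi E
    have hT : MeasurableSet T := MeasurableSet.univ_pi hE
    have hAT : ∀ ν : CountingMeasures X,
        ν ∈ (⋂ x ∈ S, g x) ↔ (fun C : S => ν.1 C.1) ∈ T := by
      intro ν
      simp only [Set.mem_iInter, T, Set.mem_univ_pi]
      constructor
      · intro H C
        have := H C.1 C.2
        rwa [← hEg C] at this
      · intro H C hC
        rw [← hEg ⟨C, hC⟩]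
        exact H ⟨C, hC⟩
    have key := h.lintegral_coe_mul (C := fun C : S => C.1) (fun C => hS C.2) hD hfin
      (φ := T.indicator 1) (measurable_one.indicator hT)
    rw [withDensity_apply _ hA, Measure.map_apply measurable_addPoint hA,
      Measure.prod_apply_symm (measurable_addPoint hA), ← lintegral_indicator hA,
      lintegral_map ((CountingMeasures.measurable_coe hD).indicator hA) h.measurable]
    convert key using 1
    · refine lintegral_congr fun ω => ?_
      by_cases hω : ξ ω ∈ ⋂ x ∈ S, g x
      · rw [Set.indicator_of_mem hω, Set.indicator_of_mem ((hAT _).1 hω)]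
        simp
      · rw [Set.indicator_of_notMem hω, Set.indicator_of_notMem (mt (hAT _).2 hω)]
        simp
    · refine lintegral_congr fun x => ?_
      have hm : Measurable fun ν : CountingMeasures X => addPoint x ν :=
        measurable_id.addPoint measurable_const
      have hs : (fun ν : CountingMeasures X => (ν, x)) ⁻¹'
          ((fun p : CountingMeasures X × X => addPoint p.2 p.1) ⁻¹' ⋂ x ∈ S, g x)
          = (fun ν => addPoint x ν) ⁻¹' ⋂ x ∈ S, g x := rfl
      rw [hs, ← lintegral_indicator_one (hm hA), lintegral_map
        (measurable_one.indicator (hm hA)) h.measurable]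
      refine lintegral_congr fun ω => ?_
      by_cases hω : addPoint x (ξ ω) ∈ ⋂ x ∈ S, g x
      · rw [Set.indicator_of_mem (Set.mem_preimage.2 hω), Set.indicator_of_mem ((hAT _).1 hω)]
        rfl
      · rw [Set.indicator_of_notMem (Set.mem_preimage.not.2 hω),
          Set.indicator_of_notMem (mt (hAT _).2 hω)]
  · rw [huniv, Measure.map_apply measurable_addPoint .univ]
    rw [Set.preimage_univ, ← Set.univ_prod_univ, Measure.prod_prod, measure_univ, one_mul,
      Measure.restrict_apply_univ]

/-- The mean count of `B` is finite, so almost surely `restrictKernel` is the true restriction to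
`B`. The equation is then one between finite measures, checked on rectangles `A ×ˢ D` by
`IsPoissonProcess.withDensity_eq` for `D ∩ B`. -/
theorem IsPoissonProcess.isMeckeTriple (h : IsPoissonProcess ξ μ P) [IsProbabilityMeasure P]
    [SigmaFinite μ] {B : Set X} (hB : MeasurableSet B) (hfin : μ B ≠ ∞) :
    IsMeckeTriple (P.map ξ) (μ.restrict B) (restrictKernel hB) := by
  have hP : IsProbabilityMeasure (P.map ξ) :=
    Measure.isProbabilityMeasure_map h.measurable.aemeasurable
  have hae : ∀ᵐ ν ∂P.map ξ, ν.1 B ≠ ∞ :=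
    (ae_lt_top (CountingMeasures.measurable_coe hB) (by rwa [h.lintegral_coe hB hfin])).mono
      fun _ hν => hν.ne
  have hτ : Measurable fun p : CountingMeasures X × X => (addPoint p.2 p.1, p.2) := by fun_prop
  refine ⟨?_, ?_, ?_⟩
  · have huniv : (P.map ξ ⊗ₘ restrictKernel hB) Set.univ = μ B := by
      rw [Measure.compProd_apply .univ, ← h.lintegral_coe hB hfin]
      refine lintegral_congr_ae ?_
      filter_upwards [hae] with ν hν
      simp [restrictKernel_apply hB hν]
    have : IsFiniteMeasure (P.map ξ ⊗ₘ restrictKernel hB) := ⟨by rw [huniv]; exact hfin.lt_top⟩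
    refine Measure.ext_prod fun {A D} hA hD => ?_
    have hDB := h.withDensity_eq (hD.inter hB)
      (measure_ne_top_of_subset Set.inter_subset_right hfin)
    have := congrArg (fun m => m A) hDB
    simp only [withDensity_apply _ hA, Measure.map_apply measurable_addPoint hA,
      Measure.prod_apply (measurable_addPoint hA)] at this
    rw [Measure.compProd_apply_prod hA hD, Measure.map_apply hτ (hA.prod hD),
      Measure.prod_apply (hτ (hA.prod hD))]
    trans ∫⁻ ν in A, ν.1 (D ∩ B) ∂P.map ξ
    · refine lintegral_congr_ae (ae_restrict_of_ae ?_)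
      filter_upwards [hae] with ν hν
      rw [restrictKernel_apply hB hν, Measure.restrict_apply hD]
    · rw [this]
      refine lintegral_congr fun ν => ?_
      have hm : MeasurableSet {x | addPoint x ν ∈ A} :=
        (measurable_const.addPoint measurable_id) hA
      have h1 : Prod.mk ν ⁻¹' ((fun p : CountingMeasures X × X => addPoint p.2 p.1) ⁻¹' A)
        = {x | addPoint x ν ∈ A} := rfl
      have h2 : Prod.mk ν ⁻¹' ((fun p : CountingMeasures X × X => (addPoint p.2 p.1, p.2)) ⁻¹'
        A ×ˢ D) = {x | addPoint x ν ∈ A} ∩ D := rfl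
      rw [h1, h2, Measure.restrict_apply hm, Measure.restrict_apply (hm.inter hD),
        Set.inter_assoc]
  · filter_upwards [hae] with ν hν
    refine (ae_restrict_iff' hB).2 (ae_of_all _ fun x hx => ?_)
    have hν' : (addPoint x ν).1 B ≠ ∞ := by
      rw [addPoint_apply _ _ hB]
      simp [hx, hν]
    rw [restrictKernel_apply hB hν, restrictKernel_apply hB hν']
    simp only [addPoint, Measure.restrict_add]
    classical
    rw [restrict_dirac' hB, if_pos hx]
  · filter_upwards [hae] with ν hν
    obtain ⟨n, hn⟩ := ν.exists_nat_of_ne_top hB hν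
    exact ⟨n, by simp [restrictKernel_apply hB hν, hn]⟩

/-! ### Compensated sums: duality and isometry -/

/-- Removing a point is measurable: the count of `B` is recovered by subtracting the indicator,
which is finite, so infinite counts cause no trouble. -/
theorem measurable_prodMk_of_addPoint {Y : Type*} [MeasurableSpace Y] {g : Y → CountingMeasures X}
    {h : Y → X} (hgh : Measurable fun y => (addPoint (h y) (g y), h y)) :
    Measurable fun y => (g y, h y) := by
  have hh : Measurable h := measurable_snd.comp hgh
  have hg : Measurable fun y => addPoint (h y) (g y) := measurable_fst.comp hgh
  refine Measurable.prodMk (CountingMeasures.measurable_of_coe fun B hB => ?_) hh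
  have : (fun y => (g y).1 B) = fun y => (addPoint (h y) (g y)).1 B - B.indicator 1 (h y) := by
    funext y
    rw [addPoint_apply _ _ hB, ENNReal.add_sub_cancel_right]
    by_cases hp : h y ∈ B <;> simp [hp]
  rw [this]
  exact ((CountingMeasures.measurable_coe hB).comp hg).sub ((measurable_one.indicator hB).comp hh)

/-- Every measurable function of `(ν, x)` is a measurable function of `(ν + δ_x, x)`. -/
theorem exists_measurable_addPoint_eq {v : CountingMeasures X × X → ℝ} (hv : Measurable v) :
    ∃ w : CountingMeasures X × X → ℝ, Measurable w ∧ ∀ ν x, w (addPoint x ν, x) = v (ν, x) := by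
  let τ : CountingMeasures X × X → CountingMeasures X × X := fun p => (addPoint p.2 p.1, p.2)
  -- With the σ-field generated by `τ` on the source, the identity is measurable, so the Doob–Dynkin
  -- factorisation applies to `v`.
  have hid := @measurable_prodMk_of_addPoint X _ _
    (MeasurableSpace.comap τ Prod.instMeasurableSpace) Prod.fst Prod.snd (comap_measurable τ)
  obtain ⟨w, hw, hvw⟩ := Measurable.exists_eq_measurable_comp (f := τ) (hv.comp hid)
  exact ⟨w, hw, fun ν x => (congrFun hvw (ν, x)).symm⟩

/-- The compensated sum `∫ w(ν, x) κ(ν, dx) - ∫ v(ν, x) ρ(dx)`, where `w(ν + δ_x, x) = v(ν, x)`. -/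
noncomputable def compensatedSum (ρ : Measure X) (κ : Kernel (CountingMeasures X) X)
    (v w : CountingMeasures X × X → ℝ) (ν : CountingMeasures X) : ℝ :=
  ∫ x, w (ν, x) ∂κ ν - ∫ x, v (ν, x) ∂ρ

namespace IsMeckeTriple

variable {Q : Measure (CountingMeasures X)} {ρ : Measure X} {κ : Kernel (CountingMeasures X) X}

theorem integrable_iff (h : IsMeckeTriple Q ρ κ) {g : CountingMeasures X × X → ℝ}
    (hg : Measurable g) :
    Integrable g (Q ⊗ₘ κ) ↔ Integrable (fun p => g (addPoint p.2 p.1, p.2)) (Q.prod ρ) := by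
  rw [h.compProd_eq, integrable_map_measure hg.aestronglyMeasurable
    (Measurable.aemeasurable (by fun_prop))]
  rfl

theorem measurable_count : Measurable fun ν => κ ν Set.univ := κ.measurable_coe .univ

theorem count_addPoint (h : IsMeckeTriple Q ρ κ) :
    ∀ᵐ ν ∂Q, ∀ᵐ x ∂ρ, κ (addPoint x ν) Set.univ = κ ν Set.univ + 1 := by
  filter_upwards [h.ae_addPoint] with ν hν
  filter_upwards [hν] with x hx
  simp [hx]

theorem ae_isFiniteMeasure (h : IsMeckeTriple Q ρ κ) : ∀ᵐ ν ∂Q, IsFiniteMeasure (κ ν) := by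
  filter_upwards [h.ae_nat] with ν ⟨n, hn⟩
  exact ⟨by simp [hn]⟩

theorem norm_compensatedSum_le {v w : CountingMeasures X × X → ℝ} {K : ℝ}
    (hv : ∀ p, ‖v p‖ ≤ K) (hw : ∀ p, ‖w p‖ ≤ K) {ν : CountingMeasures X}
    [IsFiniteMeasure ρ] [IsFiniteMeasure (κ ν)] :
    ‖compensatedSum ρ κ v w ν‖ ≤ K * (κ ν).real Set.univ + K * ρ.real Set.univ :=
  (norm_sub_le _ _).trans (add_le_add
    (norm_integral_le_of_norm_le_const (ae_of_all _ fun _ => hw _))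
    (norm_integral_le_of_norm_le_const (ae_of_all _ fun _ => hv _)))
-- The commutation rule D_x δ(v) = v_x + δ(D_x v), with δ the compensated sum: the new point
-- contributes its own summand, and the remaining summands change by their differences.
theorem compensatedSum_addPoint {v w : CountingMeasures X × X → ℝ} (hv : Measurable v)
    (hw : Measurable w) {K : ℝ} (hvK : ∀ p, ‖v p‖ ≤ K) (hwK : ∀ p, ‖w p‖ ≤ K)
    (hvw : ∀ ν x, w (addPoint x ν, x) = v (ν, x)) {ν : CountingMeasures X} {x : X}
    [IsFiniteMeasure ρ] [IsFiniteMeasure (κ ν)] (hx : κ (addPoint x ν) = κ ν + Measure.dirac x) :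
    compensatedSum ρ κ v w (addPoint x ν) - compensatedSum ρ κ v w ν
      = v (ν, x) + compensatedSum ρ κ (fun p => v (addPoint x p.1, p.2) - v p)
          (fun p => w (addPoint x p.1, p.2) - w p) ν := by
  have iw : ∀ ν' (m : Measure X) [IsFiniteMeasure m], Integrable (fun y => w (ν', y)) m :=
    fun ν' m _ => .of_bound (Measurable.aestronglyMeasurable (by fun_prop)) K
      (ae_of_all _ fun _ => hwK _)
  have iv : ∀ ν' (m : Measure X) [IsFiniteMeasure m], Integrable (fun y => v (ν', y)) m :=
    fun ν' m _ => .of_bound (Measurable.aestronglyMeasurable (by fun_prop)) K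
      (ae_of_all _ fun _ => hvK _)
  simp only [compensatedSum]
  rw [hx, integral_add_measure (iw _ _) (iw _ _), integral_sub (iw _ _) (iw _ _),
    integral_sub (iv _ _) (iv _ _), integral_dirac' _ _
      (Measurable.stronglyMeasurable (by fun_prop)), hvw]
  ring

variable [IsProbabilityMeasure Q] [IsSFiniteKernel κ]

theorem integral_eq [SFinite ρ] (h : IsMeckeTriple Q ρ κ) {g : CountingMeasures X × X → ℝ}
    (hg : Measurable g) (hi : Integrable (fun p => g (addPoint p.2 p.1, p.2)) (Q.prod ρ)) :
    ∫ ν, ∫ x, g (ν, x) ∂κ ν ∂Q = ∫ p, g (addPoint p.2 p.1, p.2) ∂Q.prod ρ := by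
  rw [← Measure.integral_compProd ((h.integrable_iff hg).2 hi), h.compProd_eq,
    integral_map (Measurable.aemeasurable (by fun_prop)) hg.aestronglyMeasurable]
variable [IsFiniteMeasure ρ]

theorem lintegral_eq (h : IsMeckeTriple Q ρ κ) {g : CountingMeasures X × X → ℝ≥0∞}
    (hg : Measurable g) :
    ∫⁻ ν, ∫⁻ x, g (ν, x) ∂κ ν ∂Q = ∫⁻ ν, ∫⁻ x, g (addPoint x ν, x) ∂ρ ∂Q := by
  rw [← Measure.lintegral_compProd hg, h.compProd_eq, lintegral_map hg (by fun_prop),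
    lintegral_prod _ (by fun_prop)]

theorem lintegral_count (h : IsMeckeTriple Q ρ κ) : ∫⁻ ν, κ ν Set.univ ∂Q = ρ Set.univ := by
  have := h.lintegral_eq (g := fun _ => 1) measurable_const
  simpa using this

/-- Mecke's equation for the count N itself gives E[N²] = ρ(X) E[N + 1]. This second moment puts
compensated sums of bounded integrands in L² and makes N F integrable for F in L². -/
theorem lintegral_count_sq (h : IsMeckeTriple Q ρ κ) :
    ∫⁻ ν, (κ ν Set.univ) ^ 2 ∂Q ≠ ∞ := by
  have h1 := h.lintegral_eq (g := fun p => κ p.1 Set.univ)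
    (measurable_count.comp measurable_fst)
  simp only [lintegral_const, ← sq] at h1
  have h2 : ∫⁻ ν, ∫⁻ x, κ (addPoint x ν) Set.univ ∂ρ ∂Q
      = ∫⁻ ν, (κ ν Set.univ + 1) * ρ Set.univ ∂Q := by
    refine lintegral_congr_ae ?_
    filter_upwards [h.count_addPoint] with ν hν
    rw [lintegral_congr_ae hν, lintegral_const]
  rw [h1, h2, lintegral_mul_const _ (measurable_count.add_const _),
    lintegral_add_right _ measurable_const, h.lintegral_count]
  simp [ENNReal.mul_eq_top]

theorem memLp_count (h : IsMeckeTriple Q ρ κ) : MemLp (fun ν => (κ ν).real Set.univ) 2 Q := by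
  have hm : Measurable fun ν => (κ ν).real Set.univ := measurable_count.ennreal_toReal
  refine ⟨hm.aestronglyMeasurable, ?_⟩
  rw [eLpNorm_lt_top_iff_lintegral_rpow_enorm_lt_top (by simp) (by simp)]
  refine lt_of_le_of_lt (lintegral_mono fun ν => ?_) h.lintegral_count_sq.lt_top
  simp only [ENNReal.toReal_ofNat, ENNReal.rpow_ofNat]
  gcongr
  rw [Measure.real, Real.enorm_eq_ofReal ENNReal.toReal_nonneg]
  exact ENNReal.ofReal_toReal_le

theorem integrable_comp_fst (h : IsMeckeTriple Q ρ κ) {F : CountingMeasures X → ℝ}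
    (hF : Measurable F) (hF2 : MemLp F 2 Q) :
    Integrable (fun p : CountingMeasures X × X => F p.1) (Q ⊗ₘ κ) := by
  rw [Measure.integrable_compProd_iff (Measurable.aestronglyMeasurable (by fun_prop))]
  constructor
  · filter_upwards [h.ae_isFiniteMeasure] with ν hν
    exact integrable_const _
  · simp only [integral_const, smul_eq_mul]
    exact h.memLp_count.integrable_mul hF2.norm

theorem integrable_comp_addPoint (h : IsMeckeTriple Q ρ κ) {F : CountingMeasures X → ℝ}
    (hF : Measurable F) (hF2 : MemLp F 2 Q) :
    Integrable (fun p : CountingMeasures X × X => F (addPoint p.2 p.1)) (Q.prod ρ) :=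
  (h.integrable_iff (g := fun p => F p.1) (by fun_prop)).1 (h.integrable_comp_fst hF hF2)

theorem _root_.measurable_compensatedSum {v w : CountingMeasures X × X → ℝ} (hv : Measurable v)
    (hw : Measurable w) : Measurable (compensatedSum ρ κ v w) := by
  refine Measurable.sub ?_ ?_
  · exact (hw.stronglyMeasurable.integral_kernel_prod_right' (κ := κ)).measurable
  · exact (hv.stronglyMeasurable.integral_prod_right' (ν := ρ)).measurable

theorem memLp_compensatedSum (h : IsMeckeTriple Q ρ κ) {v w : CountingMeasures X × X → ℝ}
    (hv : Measurable v) (hw : Measurable w) {K : ℝ} (hvK : ∀ p, ‖v p‖ ≤ K) (hwK : ∀ p, ‖w p‖ ≤ K) :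
    MemLp (compensatedSum ρ κ v w) 2 Q := by
  refine MemLp.of_le ((h.memLp_count.const_mul K).add (memLp_const (K * ρ.real Set.univ)))
    (measurable_compensatedSum hv hw).aestronglyMeasurable ?_
  filter_upwards [h.ae_isFiniteMeasure] with ν hν
  exact (norm_compensatedSum_le hvK hwK).trans (Real.le_norm_self _)

/-- Duality between the compensated sum and the difference operator. -/
theorem integral_mul_compensatedSum (h : IsMeckeTriple Q ρ κ) {F : CountingMeasures X → ℝ}
    (hF : Measurable F) (hF2 : MemLp F 2 Q) {v w : CountingMeasures X × X → ℝ}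
    (hv : Measurable v) (hw : Measurable w) {K : ℝ} (hvK : ∀ p, ‖v p‖ ≤ K)
    (hvw : ∀ ν x, w (addPoint x ν, x) = v (ν, x)) :
    Integrable (fun p : CountingMeasures X × X => (F (addPoint p.2 p.1) - F p.1) * v p) (Q.prod ρ) ∧
    ∫ ν, F ν * compensatedSum ρ κ v w ν ∂Q
      = ∫ p, (F (addPoint p.2 p.1) - F p.1) * v p ∂Q.prod ρ := by
  have i1 : Integrable (fun p => F (addPoint p.2 p.1) * v p) (Q.prod ρ) :=
    (h.integrable_comp_addPoint hF hF2).mul_bdd hv.aestronglyMeasurable (ae_of_all _ hvK)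
  have i2 : Integrable (fun p : CountingMeasures X × X => F p.1 * v p) (Q.prod ρ) :=
    ((hF2.integrable (by norm_num)).comp_fst ρ).mul_bdd hv.aestronglyMeasurable (ae_of_all _ hvK)
  -- Mecke's equation for F(ν) w(ν, x) turns the sum over points into the integral of F(ν + δ_x)
  -- v(ν, x).
  have hg : Measurable fun p : CountingMeasures X × X => F p.1 * w p := by fun_prop
  have e1 := h.integral_eq hg (by simpa only [hvw] using i1)
  have i3 : Integrable (fun ν => ∫ x, F ν * w (ν, x) ∂κ ν) Q :=
    ((h.integrable_iff hg).2 (by simpa only [hvw] using i1)).integral_compProd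
  have e2 := integral_prod _ i2
  have i4 := i2.integral_prod_left
  simp only [hvw, integral_const_mul] at e1 i3 e2 i4
  constructor
  · simp only [sub_mul]
    exact i1.sub i2
  · simp only [compensatedSum, mul_sub, sub_mul]
    rw [integral_sub i3 i4, e1, ← e2, integral_sub i1 i2]

/-- The isometry formula for the compensated sum of a bounded function. -/
theorem integral_compensatedSum_sq (h : IsMeckeTriple Q ρ κ) {v w : CountingMeasures X × X → ℝ}
    (hv : Measurable v) (hw : Measurable w) {K : ℝ} (hvK : ∀ p, ‖v p‖ ≤ K) (hwK : ∀ p, ‖w p‖ ≤ K)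
    (hvw : ∀ ν x, w (addPoint x ν, x) = v (ν, x)) :
    ∫ ν, compensatedSum ρ κ v w ν ^ 2 ∂Q = ∫ p, v p ^ 2 ∂Q.prod ρ
      + ∫ x, ∫ p, (v (addPoint p.2 p.1, x) - v (p.1, x)) * (v (addPoint x p.1, p.2) - v p)
          ∂Q.prod ρ ∂ρ := by
  let δ : X → CountingMeasures X → ℝ := fun x => compensatedSum ρ κ
    (fun p => v (addPoint x p.1, p.2) - v p) (fun p => w (addPoint x p.1, p.2) - w p)
  have hx : ∀ x, Measurable fun p : CountingMeasures X × X => (addPoint x p.1, p.2) := fun x =>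
    (measurable_fst.addPoint measurable_const).prodMk measurable_snd
  have hdv : ∀ x p, ‖v (addPoint x p.1, p.2) - v p‖ ≤ 2 * K := fun x p =>
    (norm_sub_le _ _).trans (by linarith [hvK (addPoint x p.1, p.2), hvK p])
  have hdw : ∀ x p, ‖w (addPoint x p.1, p.2) - w p‖ ≤ 2 * K := fun x p =>
    (norm_sub_le _ _).trans (by linarith [hwK (addPoint x p.1, p.2), hwK p])
  -- Duality is used twice: here with F the compensated sum itself, whose difference is then
  -- expanded by the commutation rule, and in `e3` with F = v(·, x) for fixed x.
  obtain ⟨i1, e1⟩ := h.integral_mul_compensatedSum (measurable_compensatedSum hv hw)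
    (h.memLp_compensatedSum hv hw hvK hwK) hv hw hvK hvw
  have i2 : Integrable (fun p => v p ^ 2) (Q.prod ρ) := by
    refine .of_bound (Measurable.aestronglyMeasurable (by fun_prop)) (K ^ 2)
      (ae_of_all _ fun p => ?_)
    rw [norm_pow]
    exact pow_le_pow_left₀ (norm_nonneg _) (hvK p) 2
  have hδ : Measurable fun p : CountingMeasures X × X => δ p.2 p.1 := by
    have hm : Measurable fun q : (CountingMeasures X × X) × X =>
        (addPoint q.1.2 q.1.1, q.2) :=
      (measurable_addPoint.comp measurable_fst).prodMk measurable_snd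
    have hm' : Measurable fun q : (CountingMeasures X × X) × X => (q.1.1, q.2) := by fun_prop
    refine Measurable.sub ?_ ?_
    · exact (((hw.comp hm).sub (hw.comp hm')).stronglyMeasurable.integral_kernel_prod_right'
        (κ := κ.comap Prod.fst measurable_fst)).measurable
    · exact (((hv.comp hm).sub (hv.comp hm')).stronglyMeasurable.integral_prod_right'
        (ν := ρ)).measurable
  have i3 : Integrable (fun p => δ p.2 p.1 * v p) (Q.prod ρ) := by
    refine Integrable.mul_bdd (c := K) ?_ hv.aestronglyMeasurable (ae_of_all _ hvK)
    refine Integrable.mono' (g := fun p => 2 * K * (κ p.1).real Set.univ + 2 * K * ρ.real Set.univ)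
      ?_ hδ.aestronglyMeasurable ?_
    · exact (((h.memLp_count.integrable (by norm_num)).const_mul (2 * K)).add
        (integrable_const _)).comp_fst ρ
    · have : ∀ᵐ p ∂Q.prod ρ, IsFiniteMeasure (κ p.1) :=
        Measure.quasiMeasurePreserving_fst.ae h.ae_isFiniteMeasure
      filter_upwards [this] with p hp
      exact norm_compensatedSum_le (hdv _) (hdw _)
  have e2 : ∫ ν, compensatedSum ρ κ v w ν ^ 2 ∂Q
      = ∫ ν, ∫ x, v (ν, x) ^ 2 + δ x ν * v (ν, x) ∂ρ ∂Q := by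
    simp only [sq]
    rw [e1, integral_prod _ i1]
    refine integral_congr_ae ?_
    filter_upwards [h.ae_addPoint, h.ae_isFiniteMeasure] with ν hν hν'
    refine integral_congr_ae ?_
    filter_upwards [hν] with x hx
    rw [compensatedSum_addPoint hv hw hvK hwK hvw hx]
    ring
  rw [e2, ← integral_prod (fun p => v p ^ 2 + δ p.2 p.1 * v p) (i2.add i3), integral_add i2 i3,
    integral_prod_symm _ i3]
  congr 1
  refine integral_congr_ae (ae_of_all _ fun x => ?_)
  have hvx : Measurable fun ν => v (ν, x) := by fun_prop
  have hvx2 : MemLp (fun ν => v (ν, x)) 2 Q :=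
    .of_bound hvx.aestronglyMeasurable K (ae_of_all _ fun ν => hvK _)
  have e3 := (h.integral_mul_compensatedSum hvx hvx2 ((hv.comp (hx x)).sub hv)
    ((hw.comp (hx x)).sub hw) (hdv x) (fun ν y => by
      simp only [Pi.sub_apply, Function.comp_apply]
      rw [addPoint_comm, hvw, hvw])).2
  simp only [mul_comm (δ _ _)]
  exact e3

end IsMeckeTriple

/-! ### Truncation and the interpolation inequality -/

theorem diffOp_comm (x y : X) (f : CountingMeasures X → ℝ) :
    diffOp x (diffOp y f) = diffOp y (diffOp x f) := by
  funext ν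
  simp only [diffOp, addPoint_comm x y]
  ring

/-- Truncation of a real number to `[-K, K]`. -/
def truncate (K a : ℝ) : ℝ := max (-K) (min a K)

theorem measurable_truncate (K : ℝ) : Measurable (truncate K) := by
  unfold truncate
  fun_prop

theorem abs_truncate_le {K : ℝ} (hK : 0 ≤ K) (a : ℝ) : |truncate K a| ≤ K := by
  unfold truncate
  rw [abs_le]
  exact ⟨le_max_left _ _, max_le (by linarith) (min_le_right _ _)⟩

theorem abs_truncate_sub_le (K a b : ℝ) : |truncate K a - truncate K b| ≤ |a - b| := by
  unfold truncate
  rw [max_comm (-K), max_comm (-K)]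
  refine (abs_max_sub_max_le_abs _ _ _).trans ((abs_min_sub_min_le_max _ _ _ _).trans ?_)
  simp

theorem truncate_eq_self {K a : ℝ} (h : |a| ≤ K) : truncate K a = a := by
  rw [abs_le] at h
  rw [truncate, min_eq_left h.2, max_eq_right h.1]

theorem truncate_sq_le_mul {K : ℝ} (hK : 0 ≤ K) (a : ℝ) : truncate K a ^ 2 ≤ a * truncate K a := by
  unfold truncate
  rcases le_total a K with h1 | h1
  · rw [min_eq_left h1]
    rcases le_total (-K) a with h2 | h2
    · rw [max_eq_right h2]; nlinarith
    · rw [max_eq_left h2]; nlinarith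
  · rw [min_eq_right h1, max_eq_right (by linarith)]; nlinarith

namespace IsMeckeTriple

variable {Q : Measure (CountingMeasures X)} [IsProbabilityMeasure Q] {ρ : Measure X}
  [IsFiniteMeasure ρ] {κ : Kernel (CountingMeasures X) X} [IsSFiniteKernel κ]

/-- Truncation makes v bounded and keeps what the formal argument needs: v² ≤ (D f) v in the
duality, and, being 1-Lipschitz, |D_x v_y| ≤ |D_x D_y f| in the isometry. -/
theorem integral_truncate_sq_le (h : IsMeckeTriple Q ρ κ) {f : CountingMeasures X → ℝ}
    (hf : Measurable f) (hf2 : MemLp f 2 Q) {K : ℝ} (hK : 0 ≤ K) {t : ℝ} (ht : 1 ≤ t)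
    (hfin : Integrable (fun q : X × CountingMeasures X × X =>
      diffOp q.1 (diffOp q.2.2 f) q.2.1 ^ 2) (ρ.prod (Q.prod ρ))) :
    ∫ p : CountingMeasures X × X, truncate K (diffOp p.2 f p.1) ^ 2 ∂Q.prod ρ
      ≤ t * ∫ ν, f ν ^ 2 ∂Q + t⁻¹ * ∫ q : X × CountingMeasures X × X,
          diffOp q.1 (diffOp q.2.2 f) q.2.1 ^ 2 ∂(ρ.prod (Q.prod ρ)) := by
  let v : CountingMeasures X × X → ℝ := fun p => truncate K (diffOp p.2 f p.1)
  have hu : Measurable fun p : CountingMeasures X × X => diffOp p.2 f p.1 :=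
    (hf.comp measurable_addPoint).sub (hf.comp measurable_fst)
  have hv : Measurable v := (measurable_truncate K).comp hu
  have hvK : ∀ p, ‖v p‖ ≤ K := fun p => abs_truncate_le hK _
  obtain ⟨w', hw', hvw'⟩ := exists_measurable_addPoint_eq hv
  -- The factorisation controls `w'` only at pairs (ν + δ_x, x); truncating again makes it bounded
  -- everywhere without changing it there.
  let w : CountingMeasures X × X → ℝ := fun p => truncate K (w' p)
  have hw : Measurable w := (measurable_truncate K).comp hw'
  have hwK : ∀ p, ‖w p‖ ≤ K := fun p => abs_truncate_le hK _
  have hvw : ∀ ν x, w (addPoint x ν, x) = v (ν, x) := fun ν x => by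
    simp only [w, hvw']
    exact truncate_eq_self (hvK (ν, x))
  let Z := compensatedSum ρ κ v w
  have hZ2 : MemLp Z 2 Q := h.memLp_compensatedSum hv hw hvK hwK
  obtain ⟨i1, e1⟩ := h.integral_mul_compensatedSum hf hf2 hv hw hvK hvw
  have e2 := h.integral_compensatedSum_sq hv hw hvK hwK hvw
  have iv : Integrable (fun p => v p ^ 2) (Q.prod ρ) := by
    refine .of_bound (Measurable.aestronglyMeasurable (by fun_prop)) (K ^ 2)
      (ae_of_all _ fun p => ?_)
    rw [norm_pow]
    exact pow_le_pow_left₀ (norm_nonneg _) (hvK p) 2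
  have l1 : ∫ p, v p ^ 2 ∂Q.prod ρ ≤ ∫ ν, f ν * Z ν ∂Q := by
    rw [e1]
    exact integral_mono iv i1 fun p => truncate_sq_le_mul hK _
  have l2 : 2 * ∫ ν, f ν * Z ν ∂Q ≤ t * ∫ ν, f ν ^ 2 ∂Q + t⁻¹ * ∫ ν, Z ν ^ 2 ∂Q := by
    rw [← integral_const_mul, ← integral_const_mul, ← integral_const_mul,
      ← integral_add (hf2.integrable_sq.const_mul t) (hZ2.integrable_sq.const_mul t⁻¹)]
    refine integral_mono ((hf2.integrable_mul hZ2).const_mul 2)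
      ((hf2.integrable_sq.const_mul t).add (hZ2.integrable_sq.const_mul t⁻¹)) fun ν => ?_
    have ht0 : 0 < t := by linarith
    have : 0 ≤ t⁻¹ * (t * f ν - Z ν) ^ 2 := by positivity
    have e : t⁻¹ * (t * f ν - Z ν) ^ 2 = t * f ν ^ 2 + t⁻¹ * Z ν ^ 2 - 2 * (f ν * Z ν) := by
      field_simp
      ring
    simp only
    linarith
  -- Both factors of the cross term are bounded by the same |D_x D_y f|, because difference
  -- operators commute.
  have l3 : ∫ x, ∫ p, (v (addPoint p.2 p.1, x) - v (p.1, x)) * (v (addPoint x p.1, p.2) - v p)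
      ∂Q.prod ρ ∂ρ ≤ ∫ q : X × CountingMeasures X × X,
          diffOp q.1 (diffOp q.2.2 f) q.2.1 ^ 2 ∂(ρ.prod (Q.prod ρ)) := by
    have hm1 : Measurable fun q : X × CountingMeasures X × X => v (addPoint q.2.2 q.2.1, q.1) :=
      hv.comp ((measurable_addPoint.comp measurable_snd).prodMk measurable_fst)
    have hm2 : Measurable fun q : X × CountingMeasures X × X => v (addPoint q.1 q.2.1, q.2.2) :=
      hv.comp ((Measurable.addPoint (by fun_prop) (by fun_prop)).prodMk (by fun_prop))
    have hle : ∀ q : X × CountingMeasures X × X,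
        |(v (addPoint q.2.2 q.2.1, q.1) - v (q.2.1, q.1)) *
          (v (addPoint q.1 q.2.1, q.2.2) - v q.2)| ≤ diffOp q.1 (diffOp q.2.2 f) q.2.1 ^ 2 := by
      rintro ⟨x, ν, y⟩
      rw [abs_mul, ← sq_abs (diffOp _ _ _), sq]
      refine mul_le_mul ?_ ?_ (abs_nonneg _) (abs_nonneg _)
      · simp only
        rw [diffOp_comm]
        exact abs_truncate_sub_le _ _ _
      · exact abs_truncate_sub_le _ _ _
    have i3 : Integrable (fun q : X × CountingMeasures X × X =>
        (v (addPoint q.2.2 q.2.1, q.1) - v (q.2.1, q.1)) *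
          (v (addPoint q.1 q.2.1, q.2.2) - v q.2)) (ρ.prod (Q.prod ρ)) :=
      hfin.mono' ((hm1.sub (hv.comp (by fun_prop))).mul
        (hm2.sub (hv.comp measurable_snd))).aestronglyMeasurable (ae_of_all _ hle)
    rw [← integral_prod _ i3]
    exact integral_mono i3 hfin fun q => (le_abs_self _).trans (hle q)
  have ht0 : t⁻¹ ≤ 1 := inv_le_one_of_one_le₀ ht
  have ht1 : 0 ≤ t⁻¹ := by positivity
  have hV : 0 ≤ ∫ p, v p ^ 2 ∂Q.prod ρ := integral_nonneg fun p => sq_nonneg _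
  change ∫ ν, Z ν ^ 2 ∂Q = _ at e2
  change ∫ p, v p ^ 2 ∂Q.prod ρ ≤ _
  rw [e2] at l2
  -- With V = E∫v², the bound reads 2V ≤ t E[f²] + t⁻¹ (V + cross term); t⁻¹ V ≤ V is absorbed
  -- because t ≥ 1.
  nlinarith [mul_le_mul_of_nonneg_left l3 ht1, mul_le_mul_of_nonneg_right ht0 hV]

theorem measurable_diffOp_diffOp {f : CountingMeasures X → ℝ} (hf : Measurable f) :
    Measurable fun q : X × CountingMeasures X × X => diffOp q.1 (diffOp q.2.2 f) q.2.1 := by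
  have hu : Measurable fun p : CountingMeasures X × X => diffOp p.2 f p.1 :=
    (hf.comp measurable_addPoint).sub (hf.comp measurable_fst)
  exact (hu.comp ((Measurable.addPoint (g := fun q : X × CountingMeasures X × X => q.2.1)
    (h := fun q => q.1) (by fun_prop) (by fun_prop)).prodMk
    (measurable_snd.comp measurable_snd))).sub (hu.comp measurable_snd)

/-- The interpolation inequality between the energies of orders `0`, `1` and `2`. -/
theorem lintegral_diffOp_sq_le (h : IsMeckeTriple Q ρ κ) {f : CountingMeasures X → ℝ}
    (hf : Measurable f) {t : ℝ} (ht : 1 ≤ t) :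
    ∫⁻ x, ∫⁻ ν, ENNReal.ofReal (diffOp x f ν ^ 2) ∂Q ∂ρ
      ≤ ENNReal.ofReal t * ∫⁻ ν, ENNReal.ofReal (f ν ^ 2) ∂Q + ENNReal.ofReal t⁻¹ *
        ∫⁻ y, ∫⁻ x, ∫⁻ ν, ENNReal.ofReal (diffOp x (diffOp y f) ν ^ 2) ∂Q ∂ρ ∂ρ := by
  have ht0 : 0 < t := by linarith
  have hu : Measurable fun p : CountingMeasures X × X => diffOp p.2 f p.1 :=
    (hf.comp measurable_addPoint).sub (hf.comp measurable_fst)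
  have hD2 := measurable_diffOp_diffOp hf
  have hA1 : ∫⁻ x, ∫⁻ ν, ENNReal.ofReal (diffOp x f ν ^ 2) ∂Q ∂ρ
      = ∫⁻ p : CountingMeasures X × X, ENNReal.ofReal (diffOp p.2 f p.1 ^ 2) ∂Q.prod ρ :=
    (lintegral_prod_symm' (fun p : CountingMeasures X × X =>
      ENNReal.ofReal (diffOp p.2 f p.1 ^ 2)) (by fun_prop)).symm
  have hA2 : ∫⁻ y, ∫⁻ x, ∫⁻ ν, ENNReal.ofReal (diffOp x (diffOp y f) ν ^ 2) ∂Q ∂ρ ∂ρ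
      = ∫⁻ q : X × CountingMeasures X × X, ENNReal.ofReal (diffOp q.1 (diffOp q.2.2 f) q.2.1 ^ 2)
          ∂(ρ.prod (Q.prod ρ)) := by
    have hm := (hD2.pow_const 2).ennreal_ofReal
    rw [lintegral_prod _ hm.aemeasurable]
    refine lintegral_congr fun x => ?_
    refine Eq.trans (lintegral_congr fun y => lintegral_congr fun ν => ?_)
      (lintegral_prod_symm' _ (hm.comp measurable_prodMk_left)).symm
    simp only [Function.comp_apply]
    rw [diffOp_comm]
  by_cases h0 : ∫⁻ ν, ENNReal.ofReal (f ν ^ 2) ∂Q = ∞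
  · rw [h0, ENNReal.mul_top (by simpa using ht0), top_add]
    exact le_top
  by_cases h2 : ∫⁻ y, ∫⁻ x, ∫⁻ ν, ENNReal.ofReal (diffOp x (diffOp y f) ν ^ 2) ∂Q ∂ρ ∂ρ = ∞
  · rw [h2, ENNReal.mul_top (by simpa using ht0), add_top]
    exact le_top
  have hf2 : MemLp f 2 Q := by
    rw [memLp_two_iff_integrable_sq hf.aestronglyMeasurable]
    exact (lintegral_ofReal_ne_top_iff_integrable (hf.pow_const 2).aestronglyMeasurable
      (ae_of_all _ fun _ => sq_nonneg _)).1 h0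
  have hfin := (lintegral_ofReal_ne_top_iff_integrable (hD2.pow_const 2).aestronglyMeasurable
      (ae_of_all _ fun _ => sq_nonneg _)).1 (hA2 ▸ h2)
  rw [hA1, hA2, ← ofReal_integral_eq_lintegral_ofReal hfin (ae_of_all _ fun _ => sq_nonneg _),
    ← ofReal_integral_eq_lintegral_ofReal hf2.integrable_sq (ae_of_all _ fun _ => sq_nonneg _),
    ← ENNReal.ofReal_mul ht0.le, ← ENNReal.ofReal_mul (by positivity),
    ← ENNReal.ofReal_add (mul_nonneg ht0.le (integral_nonneg fun _ => sq_nonneg _))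
      (mul_nonneg (by positivity) (integral_nonneg fun _ => sq_nonneg _))]
  -- The truncation level tends to infinity; Fatou's lemma suffices since the bound does not depend
  -- on it.
  have hlim : ∀ p : CountingMeasures X × X, ENNReal.ofReal (diffOp p.2 f p.1 ^ 2)
      = Filter.liminf (fun K : ℕ => ENNReal.ofReal (truncate K (diffOp p.2 f p.1) ^ 2))
        Filter.atTop := by
    intro p
    refine (Filter.Tendsto.liminf_eq ?_).symm
    refine tendsto_const_nhds.congr' ?_
    filter_upwards [Filter.eventually_ge_atTop ⌈|diffOp p.2 f p.1|⌉₊] with K hK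
    rw [truncate_eq_self (Nat.ceil_le.1 hK)]
  simp only [hlim]
  refine (lintegral_liminf_le fun K => ?_).trans ?_
  · exact (((measurable_truncate K).comp hu).pow_const 2).ennreal_ofReal
  refine Filter.liminf_le_of_le (by isBoundedDefault) fun b hb => ?_
  obtain ⟨K, hK⟩ := hb.exists
  refine hK.trans ?_
  have iv : Integrable (fun p : CountingMeasures X × X => truncate K (diffOp p.2 f p.1) ^ 2)
      (Q.prod ρ) := by
    refine .of_bound (((measurable_truncate K).comp hu).pow_const 2).aestronglyMeasurable
      ((K : ℝ) ^ 2) (ae_of_all _ fun p => ?_)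
    rw [norm_pow]
    exact pow_le_pow_left₀ (norm_nonneg _) (abs_truncate_le (Nat.cast_nonneg K) _) 2
  rw [← ofReal_integral_eq_lintegral_ofReal iv (ae_of_all _ fun _ => sq_nonneg _)]
  exact ENNReal.ofReal_le_ofReal (h.integral_truncate_sq_le hf hf2 (Nat.cast_nonneg K) ht hfin)

end IsMeckeTriple

/-! ### Energies of iterated differences -/

theorem measurable_iterDiffOp {f : CountingMeasures X → ℝ} (hf : Measurable f) (n : ℕ) :
    Measurable fun p : (Fin n → X) × CountingMeasures X => iterDiffOp n p.1 f p.2 := by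
  induction n with
  | zero => exact hf.comp measurable_snd
  | succ n ih =>
    have htail : Measurable fun p : (Fin (n + 1) → X) × CountingMeasures X => Fin.tail p.1 :=
      measurable_pi_lambda _ fun i => (measurable_pi_apply i.succ).comp measurable_fst
    refine Measurable.sub ?_ ?_
    · exact ih.comp (htail.prodMk (Measurable.addPoint measurable_snd
        ((measurable_pi_apply 0).comp measurable_fst)))
    · exact ih.comp (htail.prodMk measurable_snd)

theorem iterDiffOp_cons (n : ℕ) (x : X) (y : Fin n → X) (f : CountingMeasures X → ℝ) :
    iterDiffOp (n + 1) (Fin.cons x y : Fin (n + 1) → X) f = diffOp x (iterDiffOp n y f) := by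
  simp [iterDiffOp]

theorem lintegral_pi_succ (ρ : Measure X) [SigmaFinite ρ] (n : ℕ) {g : (Fin (n + 1) → X) → ℝ≥0∞}
    (hg : Measurable g) :
    ∫⁻ z, g z ∂Measure.pi (fun _ => ρ)
      = ∫⁻ y, ∫⁻ x, g (Fin.cons x y) ∂ρ ∂Measure.pi (fun _ : Fin n => ρ) := by
  have hmp := (measurePreserving_piFinSuccAbove (fun _ : Fin (n + 1) => ρ) 0).symm
  have e := hmp.lintegral_comp hg
  refine e.symm.trans ((lintegral_prod_symm' _ (hg.comp hmp.measurable)).trans ?_)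
  simp [MeasurableEquiv.piFinSuccAbove, Fin.insertNthEquiv]

/-- The part of the energy of order `n` coming from the counting measures in `S`. -/
noncomputable def energyOn (Q : Measure (CountingMeasures X)) (ρ : Measure X)
    (f : CountingMeasures X → ℝ) (n : ℕ) (S : Set (CountingMeasures X)) : ℝ≥0∞ :=
  ∫⁻ y : Fin n → X, ∫⁻ ν in S, ENNReal.ofReal (iterDiffOp n y f ν ^ 2) ∂Q
    ∂Measure.pi fun _ : Fin n => ρ

theorem measurable_lintegral_iterDiffOp (Q : Measure (CountingMeasures X)) [SFinite Q]
    {f : CountingMeasures X → ℝ} (hf : Measurable f) (n : ℕ) (S : Set (CountingMeasures X)) :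
    Measurable fun y => ∫⁻ ν in S, ENNReal.ofReal (iterDiffOp n y f ν ^ 2) ∂Q :=
  ((measurable_iterDiffOp hf n).pow_const 2).ennreal_ofReal.lintegral_prod_right'

theorem energyOn_zero (Q : Measure (CountingMeasures X)) (ρ : Measure X)
    (f : CountingMeasures X → ℝ) (S : Set (CountingMeasures X)) :
    energyOn Q ρ f 0 S = ∫⁻ ν in S, ENNReal.ofReal (f ν ^ 2) ∂Q := by
  simp [energyOn, iterDiffOp]

theorem energyOn_succ (Q : Measure (CountingMeasures X)) [SFinite Q] (ρ : Measure X) [SigmaFinite ρ]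
    {f : CountingMeasures X → ℝ} (hf : Measurable f) (n : ℕ) (S : Set (CountingMeasures X)) :
    energyOn Q ρ f (n + 1) S
      = ∫⁻ y : Fin n → X, ∫⁻ x, ∫⁻ ν in S, ENNReal.ofReal (diffOp x (iterDiffOp n y f) ν ^ 2) ∂Q ∂ρ
        ∂Measure.pi fun _ : Fin n => ρ := by
  rw [energyOn, lintegral_pi_succ ρ n (measurable_lintegral_iterDiffOp Q hf _ S)]
  simp only [iterDiffOp_cons]

theorem energyOn_succ_succ (Q : Measure (CountingMeasures X)) [SFinite Q] (ρ : Measure X)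
    [SigmaFinite ρ] {f : CountingMeasures X → ℝ} (hf : Measurable f) (n : ℕ)
    (S : Set (CountingMeasures X)) :
    energyOn Q ρ f (n + 2) S
      = ∫⁻ y : Fin n → X, ∫⁻ x₁, ∫⁻ x₂, ∫⁻ ν in S,
          ENNReal.ofReal (diffOp x₂ (diffOp x₁ (iterDiffOp n y f)) ν ^ 2) ∂Q ∂ρ ∂ρ
        ∂Measure.pi fun _ : Fin n => ρ := by
  have hm := measurable_lintegral_iterDiffOp Q hf (n + 2) S
  have hcons : Measurable fun p : (Fin (n + 1) → X) × X => (Fin.cons p.2 p.1 : Fin (n + 2) → X) :=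
    measurable_pi_lambda _ fun i => by
      cases i using Fin.cases with
      | zero => simpa using measurable_snd
      | succ i => simpa using! (measurable_pi_apply i).comp measurable_fst
  rw [energyOn, lintegral_pi_succ ρ (n + 1) hm,
    lintegral_pi_succ ρ n (g := fun y => ∫⁻ x, ∫⁻ ν in S,
      ENNReal.ofReal (iterDiffOp (n + 2) (Fin.cons x y : Fin (n + 2) → X) f ν ^ 2) ∂Q ∂ρ)
      ((hm.comp hcons).lintegral_prod_right')]
  simp only [iterDiffOp_cons]

theorem energyOn_iUnion_nat (Q : Measure (CountingMeasures X)) [SFinite Q] (ρ : Measure X)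
    {f : CountingMeasures X → ℝ} (hf : Measurable f) (n : ℕ) {S : ℕ → Set (CountingMeasures X)}
    (hS : ∀ i, MeasurableSet (S i)) (hd : Pairwise (Function.onFun Disjoint S))
    (hu : ∀ᵐ ν ∂Q, ν ∈ ⋃ i, S i) :
    energyOn Q ρ f n Set.univ = ∑' i, energyOn Q ρ f n (S i) := by
  simp only [energyOn]
  rw [← lintegral_tsum fun i => (measurable_lintegral_iterDiffOp Q hf n (S i)).aemeasurable]
  refine lintegral_congr fun y => ?_
  rw [← lintegral_iUnion hS hd, Measure.restrict_eq_self_of_ae_mem hu, Measure.restrict_univ]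

/-! ### Finiteness of intermediate energies -/

/-- The counting measures of which `κ` selects exactly `i` points. -/
def countLevel (κ : Kernel (CountingMeasures X) X) (i : ℕ) : Set (CountingMeasures X) :=
  {ν | κ ν Set.univ = i}

theorem measurableSet_countLevel {κ : Kernel (CountingMeasures X) X} (i : ℕ) :
    MeasurableSet (countLevel κ i) :=
  IsMeckeTriple.measurable_count (measurableSet_singleton _)

theorem IsMeckeTriple.energyOn_eq_tsum {Q : Measure (CountingMeasures X)} [SFinite Q]
    {ρ : Measure X} {κ : Kernel (CountingMeasures X) X} (h : IsMeckeTriple Q ρ κ)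
    {f : CountingMeasures X → ℝ}
    (hf : Measurable f) (n : ℕ) :
    energyOn Q ρ f n Set.univ = ∑' i, energyOn Q ρ f n (countLevel κ i) := by
  refine energyOn_iUnion_nat Q ρ hf n measurableSet_countLevel ?_ ?_
  · intro i j hij
    rw [Function.onFun, Set.disjoint_left]
    intro ν hi hj
    exact hij (by exact_mod_cast (show κ ν Set.univ = i from hi).symm.trans hj)
  · filter_upwards [h.ae_nat] with ν hν
    exact Set.mem_iUnion.2 hν

namespace IsMeckeTriple

variable {Q : Measure (CountingMeasures X)} [IsProbabilityMeasure Q] {ρ : Measure X}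
  [IsFiniteMeasure ρ] {κ : Kernel (CountingMeasures X) X} [IsSFiniteKernel κ]

theorem energyOn_succ_le (h : IsMeckeTriple Q ρ κ) {f : CountingMeasures X → ℝ}
    (hf : Measurable f) (n : ℕ) {t : ℝ} (ht : 1 ≤ t) :
    energyOn Q ρ f (n + 1) Set.univ ≤ ENNReal.ofReal t * energyOn Q ρ f n Set.univ
      + ENNReal.ofReal t⁻¹ * energyOn Q ρ f (n + 2) Set.univ := by
  have hm := measurable_lintegral_iterDiffOp Q hf n Set.univ
  rw [energyOn_succ Q ρ hf, energyOn_succ_succ Q ρ hf, energyOn, ← lintegral_const_mul _ hm,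
    ← lintegral_const_mul' _ _ ENNReal.ofReal_ne_top,
    ← lintegral_add_left (hm.const_mul _)]
  refine lintegral_mono fun y => ?_
  simp only [Measure.restrict_univ]
  exact h.lintegral_diffOp_sq_le ((measurable_iterDiffOp hf n).comp measurable_prodMk_left) ht

/-- Mecke's equation for g restricted to level i + 1: there κ has mass i + 1, and adding a point
reaches that level exactly from level i. -/
theorem lintegral_countLevel (h : IsMeckeTriple Q ρ κ) {g : CountingMeasures X → ℝ≥0∞}
    (hg : Measurable g) (i : ℕ) :
    ((i + 1 : ℕ) : ℝ≥0∞) * ∫⁻ ν in countLevel κ (i + 1), g ν ∂Q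
      = ∫⁻ x, ∫⁻ ν in countLevel κ i, g (addPoint x ν) ∂Q ∂ρ := by
  have hS := measurableSet_countLevel (κ := κ) i
  have hS' := measurableSet_countLevel (κ := κ) (i + 1)
  have e := h.lintegral_eq (g := fun p => (countLevel κ (i + 1)).indicator g p.1)
    ((hg.indicator hS').comp measurable_fst)
  have e1 : ∫⁻ ν, ∫⁻ x, (countLevel κ (i + 1)).indicator g ν ∂κ ν ∂Q
      = ((i + 1 : ℕ) : ℝ≥0∞) * ∫⁻ ν in countLevel κ (i + 1), g ν ∂Q := by
    rw [← lintegral_const_mul _ hg, ← lintegral_indicator hS']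
    refine lintegral_congr fun ν => ?_
    by_cases hν : ν ∈ countLevel κ (i + 1)
    · simp only [lintegral_const, Set.indicator_of_mem hν]
      rw [show κ ν Set.univ = _ from hν, mul_comm]
    · simp [Set.indicator_of_notMem hν]
  have e2 : ∫⁻ ν, ∫⁻ x, (countLevel κ (i + 1)).indicator g (addPoint x ν) ∂ρ ∂Q
      = ∫⁻ ν in countLevel κ i, ∫⁻ x, g (addPoint x ν) ∂ρ ∂Q := by
    rw [← lintegral_indicator hS]
    refine lintegral_congr_ae ?_
    filter_upwards [h.count_addPoint] with ν hν
    by_cases hν' : ν ∈ countLevel κ i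
    · rw [Set.indicator_of_mem hν']
      refine lintegral_congr_ae ?_
      filter_upwards [hν] with x hx
      refine Set.indicator_of_mem ?_ _
      change κ (addPoint x ν) Set.univ = _
      rw [hx, show κ ν Set.univ = _ from hν']
      push_cast
      rfl
    · rw [Set.indicator_of_notMem hν', ← lintegral_zero (μ := ρ)]
      refine lintegral_congr_ae ?_
      filter_upwards [hν] with x hx
      refine Set.indicator_of_notMem (fun hmem => hν' ?_) _
      change κ (addPoint x ν) Set.univ = _ at hmem
      rw [hx] at hmem
      push_cast at hmem
      exact (ENNReal.add_left_inj ENNReal.one_ne_top).1 hmem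
  rw [← e1, e, e2]
  exact lintegral_lintegral_swap (hg.comp measurable_addPoint).aemeasurable

theorem lintegral_countLevel_sq_le (h : IsMeckeTriple Q ρ κ) {g : CountingMeasures X → ℝ}
    (hg : Measurable g) (i : ℕ) :
    ((i + 1 : ℕ) : ℝ≥0∞) * ∫⁻ ν in countLevel κ (i + 1), ENNReal.ofReal (g ν ^ 2) ∂Q
      ≤ 2 * ρ Set.univ * ∫⁻ ν in countLevel κ i, ENNReal.ofReal (g ν ^ 2) ∂Q
        + 2 * ∫⁻ x, ∫⁻ ν in countLevel κ i, ENNReal.ofReal (diffOp x g ν ^ 2) ∂Q ∂ρ := by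
  rw [h.lintegral_countLevel (g := fun ν => ENNReal.ofReal (g ν ^ 2)) (by fun_prop),
    mul_assoc, ← mul_add, mul_comm (ρ _), ← lintegral_const,
    ← lintegral_add_left measurable_const, ← lintegral_const_mul' _ _ (by simp)]
  refine lintegral_mono fun x => ?_
  rw [← lintegral_add_left (by fun_prop), ← lintegral_const_mul' _ _ (by simp)]
  refine lintegral_mono fun ν => ?_
  rw [← ENNReal.ofReal_add (by positivity) (by positivity),
    ← ENNReal.ofReal_ofNat, ← ENNReal.ofReal_mul (by positivity)]
  refine ENNReal.ofReal_le_ofReal ?_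
  simp only [diffOp]
  nlinarith [sq_nonneg (g (addPoint x ν) - 2 * g ν)]

theorem lintegral_countLevel_diffOp_sq_le (h : IsMeckeTriple Q ρ κ) {g : CountingMeasures X → ℝ}
    (hg : Measurable g) (i : ℕ) :
    ∫⁻ x, ∫⁻ ν in countLevel κ i, ENNReal.ofReal (diffOp x g ν ^ 2) ∂Q ∂ρ
      ≤ 2 * ρ Set.univ * ∫⁻ ν in countLevel κ i, ENNReal.ofReal (g ν ^ 2) ∂Q
        + 2 * (((i + 1 : ℕ) : ℝ≥0∞) *
          ∫⁻ ν in countLevel κ (i + 1), ENNReal.ofReal (g ν ^ 2) ∂Q) := by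
  rw [h.lintegral_countLevel (g := fun ν => ENNReal.ofReal (g ν ^ 2)) (by fun_prop),
    mul_assoc, ← mul_add, mul_comm (ρ _), ← lintegral_const,
    ← lintegral_add_left measurable_const, ← lintegral_const_mul' _ _ (by simp)]
  refine lintegral_mono fun x => ?_
  rw [← lintegral_add_left (by fun_prop), ← lintegral_const_mul' _ _ (by simp)]
  refine lintegral_mono fun ν => ?_
  rw [← ENNReal.ofReal_add (by positivity) (by positivity),
    ← ENNReal.ofReal_ofNat, ← ENNReal.ofReal_mul (by positivity)]
  refine ENNReal.ofReal_le_ofReal ?_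
  simp only [diffOp]
  nlinarith [sq_nonneg (g (addPoint x ν) + g ν)]

theorem energyOn_countLevel_succ_le (h : IsMeckeTriple Q ρ κ) {f : CountingMeasures X → ℝ}
    (hf : Measurable f) (n i : ℕ) :
    ((i + 1 : ℕ) : ℝ≥0∞) * energyOn Q ρ f n (countLevel κ (i + 1))
      ≤ 2 * ρ Set.univ * energyOn Q ρ f n (countLevel κ i)
        + 2 * energyOn Q ρ f (n + 1) (countLevel κ i) := by
  have hm := fun S => measurable_lintegral_iterDiffOp Q hf n S
  rw [energyOn_succ Q ρ hf, energyOn, energyOn, ← lintegral_const_mul _ (hm _),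
    ← lintegral_const_mul _ (hm _), ← lintegral_const_mul' _ _ (by simp),
    ← lintegral_add_left ((hm _).const_mul _)]
  exact lintegral_mono fun y => h.lintegral_countLevel_sq_le
    ((measurable_iterDiffOp hf n).comp measurable_prodMk_left) i

theorem energyOn_succ_countLevel_le (h : IsMeckeTriple Q ρ κ) {f : CountingMeasures X → ℝ}
    (hf : Measurable f) (n i : ℕ) :
    energyOn Q ρ f (n + 1) (countLevel κ i)
      ≤ 2 * ρ Set.univ * energyOn Q ρ f n (countLevel κ i)
        + 2 * (((i + 1 : ℕ) : ℝ≥0∞) * energyOn Q ρ f n (countLevel κ (i + 1))) := by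
  have hm := fun S => measurable_lintegral_iterDiffOp Q hf n S
  rw [energyOn_succ Q ρ hf, energyOn, energyOn, ← lintegral_const_mul _ (hm _),
    ← lintegral_const_mul _ (hm _), ← lintegral_const_mul' _ _ (by simp),
    ← lintegral_add_left ((hm _).const_mul _)]
  exact lintegral_mono fun y => h.lintegral_countLevel_diffOp_sq_le
    ((measurable_iterDiffOp hf n).comp measurable_prodMk_left) i

/-- On a fixed level each difference costs only a finite factor and a passage to the next level, so
finiteness of the energy of order 0 propagates to all orders. -/
theorem energyOn_countLevel_ne_top (h : IsMeckeTriple Q ρ κ) {f : CountingMeasures X → ℝ}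
    (hf : Measurable f) (h0 : energyOn Q ρ f 0 Set.univ ≠ ∞) (n i : ℕ) :
    energyOn Q ρ f n (countLevel κ i) ≠ ∞ := by
  induction n generalizing i with
  | zero =>
    rw [energyOn_zero] at h0 ⊢
    exact ne_top_of_le_ne_top h0 (lintegral_mono_set (Set.subset_univ _))
  | succ n ih =>
    refine ne_top_of_le_ne_top ?_ (h.energyOn_succ_countLevel_le hf n i)
    have h1 := ih i
    have h2 := ih (i + 1)
    finiteness

/-- With m = ρ(X) and R, S the level energies of orders n and n + 1, one has (i + 1) R_{i+1} ≤ 2m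
R_i + 2 S_i. For large i this is a contraction with a summable perturbation, so R is summable. -/
theorem energyOn_ne_top_of_succ (h : IsMeckeTriple Q ρ κ) {f : CountingMeasures X → ℝ}
    (hf : Measurable f) (h0 : energyOn Q ρ f 0 Set.univ ≠ ∞) {n : ℕ}
    (hn : energyOn Q ρ f (n + 1) Set.univ ≠ ∞) : energyOn Q ρ f n Set.univ ≠ ∞ := by
  set R : ℕ → ℝ := fun i => (energyOn Q ρ f n (countLevel κ i)).toReal with hR
  set S : ℕ → ℝ := fun i => (energyOn Q ρ f (n + 1) (countLevel κ i)).toReal with hS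
  set m := (ρ Set.univ).toReal with hm
  have hRS : ∀ i : ℕ, (i + 1) * R (i + 1) ≤ 2 * m * R i + 2 * S i := by
    intro i
    have h1 := h.energyOn_countLevel_ne_top hf h0 n i
    have h2 := h.energyOn_countLevel_ne_top hf h0 (n + 1) i
    have := ENNReal.toReal_mono (by finiteness) (h.energyOn_countLevel_succ_le hf n i)
    rw [ENNReal.toReal_add (by finiteness) (by finiteness)] at this
    rw [ENNReal.toReal_mul, ENNReal.toReal_natCast] at this
    simpa [hR, hS, hm] using this
  have hR0 : ∀ i, 0 ≤ R i := fun i => ENNReal.toReal_nonneg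
  have hS0 : ∀ i, 0 ≤ S i := fun i => ENNReal.toReal_nonneg
  have hSs : Summable S := by
    refine ENNReal.summable_toReal ?_
    rwa [← h.energyOn_eq_tsum hf]
  have hRs : Summable R := by
    -- From index M on, 2m / (i + 1) ≤ 1/2.
    obtain ⟨M, hM⟩ := exists_nat_ge (4 * m)
    have hstep : ∀ i, R (i + 1 + M) ≤ 1 / 2 * R (i + M) + 2 * S (i + M) := by
      intro i
      have h1 := hRS (i + M)
      rw [show i + 1 + M = i + M + 1 by ring]
      have hpos : (1 : ℝ) ≤ ((i + M : ℕ) : ℝ) + 1 := by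
        have : (0 : ℝ) ≤ ((i + M : ℕ) : ℝ) := Nat.cast_nonneg _
        linarith
      have h4 : 4 * m ≤ ((i + M : ℕ) : ℝ) + 1 := by
        push_cast
        have : (0 : ℝ) ≤ (i : ℝ) := Nat.cast_nonneg _
        linarith
      have h5 := mul_le_mul_of_nonneg_right h4 (hR0 (i + M))
      have h6 := mul_le_mul_of_nonneg_right hpos (hS0 (i + M))
      refine le_of_mul_le_mul_left (a := ((i + M : ℕ) : ℝ) + 1) ?_ (by linarith)
      nlinarith
    rw [← summable_nat_add_iff M]
    -- The partial sums satisfy T_N ≤ T_{N+1} ≤ R_M + T_N / 2 + 2 ∑ S, which solves to this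
    -- constant.
    refine summable_of_sum_range_le (c := 2 * R M + 4 * ∑' i, S (i + M)) (fun i => hR0 _) ?_
    have hSM : Summable fun i => S (i + M) := (summable_nat_add_iff M).2 hSs
    intro N
    have hsum : ∑ i ∈ Finset.range (N + 1), R (i + M)
        ≤ R M + 1 / 2 * ∑ i ∈ Finset.range N, R (i + M) + 2 * ∑' i, S (i + M) := by
      rw [Finset.sum_range_succ']
      have := Finset.sum_le_sum fun i (_ : i ∈ Finset.range N) => hstep i
      rw [Finset.sum_add_distrib, ← Finset.mul_sum, ← Finset.mul_sum] at this
      have h7 := hSM.sum_le_tsum (Finset.range N) fun i _ => hS0 _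
      simp only [zero_add]
      linarith
    have h8 : ∑ i ∈ Finset.range N, R (i + M) ≤ ∑ i ∈ Finset.range (N + 1), R (i + M) := by
      rw [Finset.sum_range_succ]
      linarith [hR0 (N + M)]
    linarith
  rw [h.energyOn_eq_tsum hf]
  have : ∀ i, energyOn Q ρ f n (countLevel κ i) = ENNReal.ofReal (R i) := fun i =>
    (ENNReal.ofReal_toReal (h.energyOn_countLevel_ne_top hf h0 n i)).symm
  simp only [this]
  rw [← ENNReal.ofReal_tsum_of_nonneg hR0 hRs]
  exact ENNReal.ofReal_ne_top

end IsMeckeTriple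

/-! ### Chaining the interpolation inequalities -/

/-- A sequence satisfying `a (n + 1) ≤ t a n + t⁻¹ a (n + 2)` for all `t ≥ 1` satisfies
interpolation inequalities between its terms of orders `0`, `k + 1` and `k + 2`. -/
theorem exists_interpolation_const (k : ℕ) {ε : ℝ} (hε : 0 < ε) :
    ∃ C : ℝ, 0 ≤ C ∧ ∀ a : ℕ → ℝ, (∀ n, 0 ≤ a n) →
      (∀ n ≤ k, ∀ t : ℝ, 1 ≤ t → a (n + 1) ≤ t * a n + t⁻¹ * a (n + 2)) →
      a (k + 1) ≤ C * a 0 + ε * a (k + 2) := by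
  induction k generalizing ε with
  | zero =>
    refine ⟨max 1 ε⁻¹, by positivity, fun a ha h => (h 0 le_rfl _ (le_max_left 1 ε⁻¹)).trans ?_⟩
    gcongr
    · exact ha _
    · exact inv_le_of_inv_le₀ hε (le_max_right _ _)
  | succ k ih =>
    set t : ℝ := max 1 (2 * ε⁻¹) with ht
    have ht1 : 1 ≤ t := le_max_left _ _
    have ht0 : 0 < t := by linarith
    have hte : 2 * t⁻¹ ≤ ε := by
      have h2 : 2 * ε⁻¹ ≤ t := le_max_right _ _
      rw [← div_eq_mul_inv, div_le_iff₀ hε] at h2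
      rw [← div_eq_mul_inv, div_le_iff₀ ht0]
      linarith
    -- After multiplication by t the term in a (k + 2) has coefficient 1/2 and is absorbed. This
    -- doubles the coefficient of a (k + 3) to 2 t⁻¹ ≤ ε, whence the choice of t.
    obtain ⟨C, hC, H⟩ := ih (ε := (2 * t)⁻¹) (by positivity)
    refine ⟨2 * t * C, by positivity, fun a ha h => ?_⟩
    have h1 := H a ha fun n hn => h n (by omega)
    have h2 := h (k + 1) le_rfl t ht1
    have h3 := mul_le_mul_of_nonneg_left h1 ht0.le
    have h4 : t * (C * a 0 + (2 * t)⁻¹ * a (k + 2)) = t * C * a 0 + a (k + 2) / 2 := by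
      field_simp
    have h5 := mul_le_mul_of_nonneg_right hte (ha (k + 3))
    rw [h4] at h3
    change a (k + 2) ≤ t * a (k + 1) + t⁻¹ * a (k + 3) at h2
    change a (k + 2) ≤ 2 * t * C * a 0 + ε * a (k + 3)
    linarith

/-! ### Centring and localisation -/

theorem iterDiffOp_sub_const (f : CountingMeasures X → ℝ) (c : ℝ) (n : ℕ) (y : Fin (n + 1) → X) :
    iterDiffOp (n + 1) y (fun ν => f ν - c) = iterDiffOp (n + 1) y f := by
  induction n with
  | zero =>
    funext ν
    simp [iterDiffOp, diffOp]
  | succ n ih =>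
    change diffOp (y 0) (iterDiffOp (n + 1) (Fin.tail y) _) = _
    rw [ih]
    rfl

theorem energyOn_sub_const (Q : Measure (CountingMeasures X)) (ρ : Measure X)
    (f : CountingMeasures X → ℝ) (c : ℝ) (n : ℕ) (S : Set (CountingMeasures X)) :
    energyOn Q ρ (fun ν => f ν - c) (n + 1) S = energyOn Q ρ f (n + 1) S := by
  simp only [energyOn, iterDiffOp_sub_const]

theorem energyOn_restrict (Q : Measure (CountingMeasures X)) (μ : Measure X) [SigmaFinite μ]
    (f : CountingMeasures X → ℝ) (n : ℕ) (S : Set (CountingMeasures X)) (B : Set X) :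
    energyOn Q (μ.restrict B) f n S
      = ∫⁻ y in Set.univ.pi fun _ : Fin n => B,
          ∫⁻ ν in S, ENNReal.ofReal (iterDiffOp n y f ν ^ 2) ∂Q
        ∂Measure.pi fun _ => μ := by
  rw [energyOn, Measure.restrict_pi_pi]

/-- Every n-tuple lies in a power of a single spanning set, so the powers exhaust the product space
and monotone convergence applies. -/
theorem energyOn_le_of_spanningSets (Q : Measure (CountingMeasures X)) (μ : Measure X)
    [SigmaFinite μ] (f : CountingMeasures X → ℝ) (n : ℕ) (S : Set (CountingMeasures X)) {c : ℝ≥0∞}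
    (h : ∀ i, energyOn Q (μ.restrict (spanningSets μ i)) f n S ≤ c) : energyOn Q μ f n S ≤ c := by
  have hmono : Monotone fun i => Set.univ.pi fun _ : Fin n => spanningSets μ i :=
    fun i j hij => Set.pi_mono fun _ _ => monotone_spanningSets μ hij
  have hU : ⋃ i, (Set.univ.pi fun _ : Fin n => spanningSets μ i) = Set.univ := by
    refine Set.eq_univ_of_forall fun y => ?_
    refine Set.mem_iUnion.2 ⟨∑ j, spanningSetsIndex μ (y j), fun j _ => ?_⟩
    exact monotone_spanningSets μ
      (Finset.single_le_sum (f := fun j => spanningSetsIndex μ (y j)) (fun _ _ => Nat.zero_le _)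
        (Finset.mem_univ j)) (mem_spanningSetsIndex μ (y j))
  rw [energyOn, ← setLIntegral_univ, ← hU,
    setLIntegral_iUnion_of_directed _ (directed_of_isDirected_le hmono)]
  refine iSup_le fun i => ?_
  rw [← energyOn_restrict]
  exact h i

theorem diffEnergy_eq_energyOn [SFinite P] [SigmaFinite μ] (hξ : Measurable ξ)
    {f : CountingMeasures X → ℝ} (hf : Measurable f) (n : ℕ) :
    diffEnergy μ P ξ f n = energyOn (P.map ξ) μ f n Set.univ := by
  have hm := ((measurable_iterDiffOp hf n).pow_const 2).ennreal_ofReal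
  rw [diffEnergy, energyOn, lintegral_lintegral_swap]
  · refine lintegral_congr fun y => ?_
    rw [setLIntegral_univ]
    exact (lintegral_map (hm.comp measurable_prodMk_left) hξ).symm
  · exact (hm.comp (measurable_snd.prodMk (hξ.comp measurable_fst))).aemeasurable

theorem energyOn_zero_eq_variance [IsProbabilityMeasure P] (hξ : Measurable ξ) (ρ : Measure X)
    {f : CountingMeasures X → ℝ} (hf : Measurable f) (hf2 : MemLp (fun ω => f (ξ ω)) 2 P) :
    energyOn (P.map ξ) ρ (fun ν => f ν - ∫ ω, f (ξ ω) ∂P) 0 Set.univ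
      = ENNReal.ofReal (variance (fun ω => f (ξ ω)) P) := by
  rw [energyOn_zero, setLIntegral_univ, lintegral_map (by fun_prop) hξ, hf2.ofReal_variance_eq,
    evariance]
  refine lintegral_congr fun ω => ?_
  rw [← enorm_pow, Real.enorm_eq_ofReal (sq_nonneg _)]

end

/-! ### Conclusion -/

/-- For a square integrable functional of a Poisson process with intensity measure `μ`, the energy
of order `k + 1` is controlled by the variance and the energy of order `k + 2`. -/
theorem exists_diffEnergy_le (k : ℕ) {ε : ℝ} (hε : 0 < ε) :
    ∃ C : ℝ, 0 ≤ C ∧ ∀ (X : Type*) [MeasurableSpace X] (μ : Measure X) [SigmaFinite μ]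
      (Ω : Type*) [MeasurableSpace Ω] (P : Measure Ω) [IsProbabilityMeasure P]
      (ξ : Ω → CountingMeasures X), IsPoissonProcess ξ μ P →
      ∀ f : CountingMeasures X → ℝ, Measurable f → MemLp (fun ω => f (ξ ω)) 2 P →
      diffEnergy μ P ξ f (k + 2) ≠ ∞ →
      diffEnergy μ P ξ f (k + 1) ≤ ENNReal.ofReal C *
        ENNReal.ofReal (variance (fun ω => f (ξ ω)) P)
          + ENNReal.ofReal ε * diffEnergy μ P ξ f (k + 2) := by
  obtain ⟨C, hC, H⟩ := exists_interpolation_const k hε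
  refine ⟨C, hC, fun X _ μ _ Ω _ P _ ξ hξ f hf hf2 hfin => ?_⟩
  have hQ : IsProbabilityMeasure (P.map ξ) :=
    Measure.isProbabilityMeasure_map hξ.measurable.aemeasurable
  rw [diffEnergy_eq_energyOn hξ.measurable hf] at hfin ⊢
  rw [diffEnergy_eq_energyOn hξ.measurable hf]
  refine energyOn_le_of_spanningSets _ _ _ _ _ fun i => ?_
  have hB := measurableSet_spanningSets μ i
  have hμB := (measure_spanningSets_lt_top μ i).ne
  set ρ := μ.restrict (spanningSets μ i) with hρ
  have : IsFiniteMeasure ρ := ⟨by simpa [hρ] using hμB.lt_top⟩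
  have hM := hξ.isMeckeTriple hB hμB
  set g : CountingMeasures X → ℝ := fun ν => f ν - ∫ ω, f (ξ ω) ∂P with hg
  -- Centring turns the energy of order 0 into the variance and leaves the higher orders unchanged.
  have hgm : Measurable g := hf.sub_const _
  have hle : energyOn (P.map ξ) ρ f (k + 2) Set.univ ≤ energyOn (P.map ξ) μ f (k + 2) Set.univ := by
    rw [energyOn_restrict]
    exact setLIntegral_le_lintegral _ _
  have h0 := energyOn_zero_eq_variance hξ.measurable ρ hf hf2
  have h0' : energyOn (P.map ξ) ρ g 0 Set.univ ≠ ∞ := by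
    rw [h0]
    exact ENNReal.ofReal_ne_top
  -- Finiteness descends from order k + 2, so the interpolation inequalities may be read in ℝ.
  have htop : ∀ j ≤ k + 2, energyOn (P.map ξ) ρ g j Set.univ ≠ ∞ := by
    intro j hj
    refine Nat.decreasingInduction
      (motive := fun j _ => energyOn (P.map ξ) ρ g j Set.univ ≠ ∞)
      (fun j _ ih => hM.energyOn_ne_top_of_succ hgm h0' ih) ?_ hj
    rw [energyOn_sub_const]
    exact ne_top_of_le_ne_top hfin hle
  have key := H (fun j => (energyOn (P.map ξ) ρ g j Set.univ).toReal)
    (fun _ => ENNReal.toReal_nonneg) (fun n hn t ht => by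
      have h1 := htop n (by omega)
      have h2 := htop (n + 2) (by omega)
      have := ENNReal.toReal_mono (by finiteness) (hM.energyOn_succ_le hgm n ht)
      rwa [ENNReal.toReal_add (by finiteness) (by finiteness), ENNReal.toReal_mul,
        ENNReal.toReal_mul, ENNReal.toReal_ofReal (by linarith),
        ENNReal.toReal_ofReal (by positivity)] at this)
  have key' := ENNReal.ofReal_le_ofReal key
  rw [ENNReal.ofReal_add (by positivity) (by positivity), ENNReal.ofReal_mul hC,
    ENNReal.ofReal_mul hε.le, ENNReal.ofReal_toReal (htop _ (by omega)),
    ENNReal.ofReal_toReal (htop _ (by omega)), ENNReal.ofReal_toReal (htop _ (by omega)), h0,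
    hg, energyOn_sub_const, energyOn_sub_const] at key'
  refine key'.trans ?_
  gcongr

theorem mainTheorem5 (α : ℝ) (hα : 0 ≤ α) (k : ℕ) (hk : 1 ≤ k) :
    ∃ c : ℝ, 0 < c ∧
      ∀ (X : Type*) [MeasurableSpace X] (μ : Measure X) [SigmaFinite μ]
        (Ω : Type*) [MeasurableSpace Ω] (P : Measure Ω) [IsProbabilityMeasure P]
        (ξ : Ω → CountingMeasures X), IsPoissonProcess ξ μ P →
        ∀ f : CountingMeasures X → ℝ, Measurable f → MemLp (fun ω => f (ξ ω)) 2 P →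
          diffEnergy μ P ξ f (k + 1) ≤ ENNReal.ofReal α * diffEnergy μ P ξ f k →
          ENNReal.ofReal α * diffEnergy μ P ξ f k < ∞ →
          ENNReal.ofReal (1 / c) * diffEnergy μ P ξ f k
            ≤ ENNReal.ofReal (variance (fun ω => f (ξ ω)) P) := by
  obtain ⟨k, rfl⟩ : ∃ j, k = j + 1 := ⟨k - 1, by omega⟩
  -- This ε satisfies εα ≤ 1/2, also for α = 0.
  have hε : 0 < (2 * (α + 1))⁻¹ := by positivity
  obtain ⟨C, hC, H⟩ := exists_diffEnergy_le k hε
  -- Absorption gives E ≤ 2 C Var F; the extra 1 keeps the constant positive.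
  refine ⟨2 * C + 1, by positivity, fun X _ μ _ Ω _ P _ ξ hξ f hf hf2 hle hlt => ?_⟩
  have hfin : diffEnergy μ P ξ f (k + 2) ≠ ∞ := ne_top_of_le_ne_top hlt.ne hle
  have h1 := H X μ Ω P ξ hξ f hf hf2 hfin
  -- For α = 0 the hypothesis does not make this energy finite; the interpolation bound does.
  have hE : diffEnergy μ P ξ f (k + 1) ≠ ∞ := ne_top_of_le_ne_top (by finiteness) h1
  have h2 : diffEnergy μ P ξ f (k + 1) ≤ ENNReal.ofReal C *
      ENNReal.ofReal (variance (fun ω => f (ξ ω)) P) + ENNReal.ofReal (2 * (α + 1))⁻¹ *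
        (ENNReal.ofReal α * diffEnergy μ P ξ f (k + 1)) := h1.trans (by gcongr)
  have hV : 0 ≤ variance (fun ω => f (ξ ω)) P := variance_nonneg _ _
  lift diffEnergy μ P ξ f (k + 1) to NNReal using hE with E
  rw [← ENNReal.ofReal_coe_nnreal, ← ENNReal.ofReal_mul hα, ← ENNReal.ofReal_mul hε.le,
    ← ENNReal.ofReal_mul hC, ← ENNReal.ofReal_add (by positivity) (by positivity),
    ENNReal.ofReal_le_ofReal_iff (by positivity)] at h2
  rw [← ENNReal.ofReal_coe_nnreal, ← ENNReal.ofReal_mul (by positivity)]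
  refine ENNReal.ofReal_le_ofReal ?_
  have h3 : (2 * (α + 1))⁻¹ * (α * (E : ℝ)) ≤ E / 2 := by
    rw [inv_mul_le_iff₀ (by positivity)]
    nlinarith [E.coe_nonneg]
  rw [one_div, inv_mul_le_iff₀ (by positivity)]
  nlinarith
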